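/- Let $d\ge 2$ be a fixed integer. For each index $m\in\mathbb N$ let $\mathbf n=(n_1,\dots,n_d)$ and $\mathbf k=(k_1,\dots,k_d)$ be tuples of natural numbers with $k_i\le n_i$, and let $\lambda\in\mathbb R$ (all depending on $m$; all limits are as $m\to\infty$). One observes $\mathcal Y=\mathcal X+\mathcal Z\in\mathbb R^{n_1\times\cdots\times n_d}$, where $\mathcal Z$ has i.i.d. $N(0,1)$ entries, and tests $$H_0:\mathcal X=0\quad\text{versus}\quad H_1:\mathcal X\in\mathscr X(\mathbf k,\mathbf n,\lambda)=\{\lambda'\,\mathbf 1_{I_1}\circ\cdots\circ\mathbf 1_{I_d}: I_i\subseteq[n_i],\ |I_i|=k_i,\ \lambda'\ge\lambda\},$$ where $\circ$ is the outer product and $\mathbf 1_I$ is the indicator vector of $I$. The minimax detection risk is $$\mathcal E^s=\inf_{\phi}\Big(\mathbb P_0(\phi=1)+\sup_{\mathcal X\in\mathscr X(\mathbf k,\mathbf n,\lambda)}\mathbb P_{\mathcal X}(\phi=0)\Big),$$ the infimum being over all measurable $\{0,1\}$-valued tests $\phi$ based on $\mathcal Y$, possibly randomized by an independent uniform variable on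 $[0,1]$. (1) Suppose that $n_i\to\infty$, $k_i\to\infty$ and $k_i/n_i\to0$ for every $i\in[d]$; that for all $i\ne j$ in $[d]$ $$\frac{\log(n_j/k_j)}{k_i}\to0,\qquad \frac{\log\log(n_i/k_i)}{\log(n_j/k_j)}\to0,\qquad k_i\log\frac{n_i}{k_i}\asymp k_j\log\frac{n_j}{k_j}$$ (where $a\asymp b$ means that $c\,a\le b\le C\,a$ for some constants $c,C>0$ and all large $m$); and that $$\frac{\lambda\prod_{i=1}^dk_i}{\sqrt{\prod_{i=1}^dn_i}}\to0,\qquad \limsup_{m\to\infty}\frac{\lambda\,(\prod_{i=1}^dk_i)^{1/2}}{\sqrt{2\sum_{i=1}^dk_i\log(n_i/k_i)}}<1 .$$ Then $\mathcal E^s\to1$. (2) Put $n=\max_in_i$, and for eventually positive sequences write $a=\tilde\Theta(b)$ if $\lim \log a/\log n$ and $\lim\log b/\log n$ exist in $\mathbb R$ and are equal. Let $0\le\alpha\le1$ and $\beta\in\mathbb R$ be fixed, and suppose that $n\to\infty$, $n_1=\cdots=n_d=\tilde\Theta(n)$, $k_1=\cdots=k_d=\tilde\Theta(n^\alpha)$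 and $\lambda=\tilde\Theta(n^{-\beta})$. If $$\beta>\max\{d\alpha-d/2,\ (d-1)\alpha/2\},$$ then $\mathcal E^s\to1$. -/

import Mathlib

open Filter Topology MeasureTheory ProbabilityTheory Asymptotics
open scoped ENNReal

namespace TensorClustering

noncomputable section

/-- Real tensors of order `d` and size `n 0 × ⋯ × n (d - 1)`. -/
abbrev Tensor {d : ℕ} (n : Fin d → ℕ) : Type := (∀ i, Fin (n i)) → ℝ

/-- The outer product `v₁ ∘ ⋯ ∘ v_d`, with entries `∏ i, (v i) (j i)`. -/
def outerProduct {d : ℕ} {n : Fin d → ℕ} (v : ∀ i, Fin (n i) → ℝ) : Tensor n :=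
  fun j => ∏ i, v i (j i)

/-- The indicator vector of a set of coordinates. -/
def indicatorVector {N : ℕ} (I : Finset (Fin N)) : Fin N → ℝ :=
  fun j => if j ∈ I then 1 else 0

/-- Signals with a constant planted cluster: `μ • 1_{I₁} ∘ ⋯ ∘ 1_{I_d}` with `|I i| = k i` and
strength `μ ≥ lam`. -/
def chcSignals {d : ℕ} (k n : Fin d → ℕ) (lam : ℝ) : Set (Tensor n) :=
  {X | ∃ I : ∀ i, Finset (Fin (n i)), (∀ i, (I i).card = k i) ∧
    ∃ μ : ℝ, lam ≤ μ ∧ X = μ • outerProduct (fun i => indicatorVector (I i))}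

/-- The law of the noise tensor, with i.i.d. standard normal entries. -/
def noiseLaw {d : ℕ} (n : Fin d → ℕ) : Measure (Tensor n) :=
  Measure.pi fun _ => gaussianReal 0 1

/-- The law of the observation `Y = X + Z` for the signal `X`. -/
def observationLaw {d : ℕ} {n : Fin d → ℕ} (X : Tensor n) : Measure (Tensor n) :=
  (noiseLaw n).map fun Z => X + Z

/-- A detection procedure with unlimited computational resources: a measurable `{0,1}`-valued
function of the observation and of an independent random seed, uniform on `[0,1]`. Procedures that
ignore the seed are the nonrandomized tests. The value `true` is the decision for the
alternative. -/
structure DetectionTest {d : ℕ} (n : Fin d → ℕ) where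
  /-- The decision, given the observation and the seed. -/
  decide : Tensor n × unitInterval → Bool
  measurable_decide : Measurable decide

/-- The joint law of the observation and of the independent seed when the signal is `X`. -/
def experimentLaw {d : ℕ} {n : Fin d → ℕ} (X : Tensor n) : Measure (Tensor n × unitInterval) :=
  (observationLaw X).prod volume

/-- The type I error plus the worst-case type II error of a test. -/
def chcDetectionRisk {d : ℕ} (k n : Fin d → ℕ) (lam : ℝ) (φ : DetectionTest n) : ℝ≥0∞ :=
  experimentLaw (0 : Tensor n) {y | φ.decide y = true} +
    ⨆ X ∈ chcSignals k n lam, experimentLaw X {y | φ.decide y = false}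

/-- The minimax detection risk over all tests. -/
def chcMinimaxRisk {d : ℕ} (k n : Fin d → ℕ) (lam : ℝ) : ℝ≥0∞ :=
  ⨅ φ : DetectionTest n, chcDetectionRisk k n lam φ

/-- The regime `n i → ∞`, `k i → ∞`, `k i / n i → 0` for every mode `i`. -/
structure GrowingSparseRegime {d : ℕ} (k n : ℕ → Fin d → ℕ) : Prop where
  size_tendsto : ∀ i, Tendsto (fun m => n m i) atTop atTop
  cluster_tendsto : ∀ i, Tendsto (fun m => k m i) atTop atTop
  sparsity_tendsto : ∀ i, Tendsto (fun m => (k m i : ℝ) / (n m i : ℝ)) atTop (𝓝 0)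

/-- The balance conditions between distinct modes. -/
structure BalancedModes {d : ℕ} (k n : ℕ → Fin d → ℕ) : Prop where
  log_div_tendsto : ∀ i j, i ≠ j →
    Tendsto (fun m => Real.log ((n m j : ℝ) / k m j) / k m i) atTop (𝓝 0)
  loglog_div_tendsto : ∀ i j, i ≠ j →
    Tendsto (fun m => Real.log (Real.log ((n m i : ℝ) / k m i)) / Real.log ((n m j : ℝ) / k m j))
      atTop (𝓝 0)
  asymp : ∀ i j, i ≠ j →
    (fun m => (k m i : ℝ) * Real.log ((n m i : ℝ) / k m i)) =Θ[atTop]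
      fun m => (k m j : ℝ) * Real.log ((n m j : ℝ) / k m j)

/-- Equality of polynomial growth orders in the scale `N`: `a` and `b` are eventually positive and
`log a / log N`, `log b / log N` have the same (existing) limit. -/
def TildeTheta (N : ℕ → ℕ) (a b : ℕ → ℝ) : Prop :=
  (∀ᶠ m in atTop, 0 < a m ∧ 0 < b m) ∧
    ∃ l : ℝ, Tendsto (fun m => Real.log (a m) / Real.log (N m)) atTop (𝓝 l) ∧
      Tendsto (fun m => Real.log (b m) / Real.log (N m)) atTop (𝓝 l)

/-- The largest mode size. -/
def maxSize {d : ℕ} (n : ℕ → Fin d → ℕ) (m : ℕ) : ℕ := Finset.univ.sup (n m)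

/-- The polynomial regime with sparsity exponent `α` and signal exponent `β`. -/
structure PolynomialRegime {d : ℕ} (k n : ℕ → Fin d → ℕ) (lam : ℕ → ℝ) (α β : ℝ) : Prop where
  alpha_mem : α ∈ Set.Icc (0 : ℝ) 1
  max_tendsto : Tendsto (maxSize n) atTop atTop
  size_eq : ∀ m i j, n m i = n m j
  size_order : ∀ i, TildeTheta (maxSize n) (fun m => n m i) (fun m => maxSize n m)
  cluster_eq : ∀ m i j, k m i = k m j
  cluster_order : ∀ i, TildeTheta (maxSize n) (fun m => k m i) (fun m => (maxSize n m : ℝ) ^ α)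
  signal_order : TildeTheta (maxSize n) lam (fun m => (maxSize n m : ℝ) ^ (-β))

/-- The statistical detection threshold `(dα - d/2) ∨ ((d-1)α/2)` for the exponent `β`. -/
def chcDetectionThreshold (d : ℕ) (α : ℝ) : ℝ :=
  max ((d : ℝ) * α - (d : ℝ) / 2) (((d : ℝ) - 1) * α / 2)

end

end TensorClustering

/-! Put the uniform prior on boxes with side lengths `k i` and strength exactly `lam`. If the
averaged likelihood ratio, possibly truncated, has first and second moments close to `1` under pure
noise, then no test beats risk `1 - o(1)` (`error_sum_ge_of_truncated_moments`). For two independent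
boxes the plain cross moment is `exp (lam ^ 2 * ∏ i, h i)`, where the overlaps `h i` are independent
hypergeometric variables whose point probabilities are at most `(e k² / (N h)) ^ h`
(`card_overlap_eq_le`).

If every overlap is within a constant factor of its mean `k² / N`, the exponent is of order `(lam ∏
k / √∏ n) ^ 2`, which vanishes. If some `h i` is larger while `lam ^ 2 * ∏ j ≠ i, h j ≤ η`, the
exponent is at most `η * h i`, and the hypergeometric tail absorbs it. These two cases settle the
polynomial regime, where `lam ^ 2 * k ^ (d - 1) → 0`.

In the sparse regime with the sharp constant, nearly full overlaps can spoil the plain second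
moment: the exponent may reach almost `2 ∑ k L` with `L = log (n / k)`, against an entropy of only
about `∑ k L`. Each likelihood ratio is therefore restricted to the event that no sub-box of its box
has an exceptional sum. Its mean is hardly changed, and the exponent is essentially halved, falling
below the entropy (`truncated_exponent_le`). `exponent_dichotomy` shows that, up to the two harmless
cases, all modes are nearly full simultaneously. -/

namespace TensorClustering

/-! ### Gaussian likelihood ratios and their truncated moments. -/

section Gaussian

variable {ι : Type*}

/-- The likelihood ratio of the mean shift by `lam` on `A` against pure noise. -/
noncomputable def shiftLikelihood (lam : ℝ) (A : Finset ι) (y : ι → ℝ) : ℝ :=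
  Real.exp (lam * ∑ j ∈ A, y j - lam ^ 2 * A.card / 2)

/-- The scan threshold for the sum over a set of `N` coordinates. -/
noncomputable def scanThreshold (lam K : ℝ) (N : ℕ) : ℝ :=
  lam * N + Real.sqrt (2 * N * K)

/-- No set of the family has an exceptionally large sum. -/
def scanEvent (lam K : ℝ) (F : Finset (Finset ι)) : Set (ι → ℝ) :=
  {y | ∀ D ∈ F, ∑ j ∈ D, y j ≤ scanThreshold lam K D.card}

theorem measurableSet_scanEvent (lam K : ℝ) (F : Finset (Finset ι)) :
    MeasurableSet (scanEvent lam K F) := by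
  have : scanEvent lam K F =
      ⋂ D ∈ F, {y : ι → ℝ | ∑ j ∈ D, y j ≤ scanThreshold lam K D.card} := by
    ext y; simp [scanEvent]
  rw [this]
  exact Finset.measurableSet_biInter _ fun D _ => measurableSet_le (by fun_prop) (by fun_prop)

/-- The likelihood ratio truncated to the scan event. -/
noncomputable def truncatedLikelihood (lam K : ℝ) (A : Finset ι) (F : Finset (Finset ι)) :
    (ι → ℝ) → ℝ :=
  (scanEvent lam K F).indicator (shiftLikelihood lam A)

theorem measurable_shiftLikelihood (lam : ℝ) (A : Finset ι) :
    Measurable (shiftLikelihood lam A) := by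
  unfold shiftLikelihood; fun_prop

theorem measurable_truncatedLikelihood (lam K : ℝ) (A : Finset ι) (F : Finset (Finset ι)) :
    Measurable (truncatedLikelihood lam K A F) :=
  (measurable_shiftLikelihood lam A).indicator (measurableSet_scanEvent lam K F)

theorem truncatedLikelihood_nonneg (lam K : ℝ) (A : Finset ι) (F : Finset (Finset ι))
    (y : ι → ℝ) : 0 ≤ truncatedLikelihood lam K A F y :=
  Set.indicator_nonneg (fun _ _ => (Real.exp_pos _).le) _

theorem truncatedLikelihood_le (lam K : ℝ) (A : Finset ι) (F : Finset (Finset ι))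
    (y : ι → ℝ) : truncatedLikelihood lam K A F y ≤ shiftLikelihood lam A y :=
  Set.indicator_le_self' (fun _ _ => (Real.exp_pos _).le) _

theorem shiftLikelihood_mul (lam : ℝ) (A B : Finset ι) (y : ι → ℝ) :
    shiftLikelihood lam A y * shiftLikelihood lam B y =
      Real.exp (lam * ∑ j ∈ A, y j + lam * ∑ j ∈ B, y j +
        (-(lam ^ 2 * A.card / 2) - lam ^ 2 * B.card / 2)) := by
  rw [shiftLikelihood, shiftLikelihood, ← Real.exp_add]
  congr 1; ring

variable [Fintype ι]

theorem exp_sum_mul_eq_prod (c y : ι → ℝ) :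
    Real.exp (∑ j, c j * y j) = ∏ j, Real.exp (c j * y j) := Real.exp_sum _ _

theorem integrable_exp_sum_mul_pi_gaussianReal (c : ι → ℝ) :
    Integrable (fun y : ι → ℝ => Real.exp (∑ j, c j * y j))
      (Measure.pi fun _ => gaussianReal 0 1) := by
  simp_rw [exp_sum_mul_eq_prod]
  exact Integrable.fintype_prod (f := fun j x => Real.exp (c j * x))
    fun j => integrable_exp_mul_gaussianReal (c j)

theorem integral_exp_sum_mul_pi_gaussianReal (c : ι → ℝ) :
    ∫ y : ι → ℝ, Real.exp (∑ j, c j * y j) ∂(Measure.pi fun _ => gaussianReal 0 1) =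
      Real.exp (∑ j, c j ^ 2 / 2) := by
  simp_rw [exp_sum_mul_eq_prod]
  rw [integral_fintype_prod_eq_prod (fun j x => Real.exp (c j * x)), Real.exp_sum]
  refine Finset.prod_congr rfl fun j _ => ?_
  have h := mgf_gaussianReal (p := gaussianReal 0 1) (X := id) (μ := 0) (v := 1)
    (Measure.map_id) (c j)
  simpa [mgf] using h

theorem gaussianReal_eq_withDensity_exp (x : ℝ) :
    gaussianReal x 1 = (gaussianReal 0 1).withDensity
      (fun y => ENNReal.ofReal (Real.exp (x * y - x ^ 2 / 2))) := by
  rw [gaussianReal_of_var_ne_zero _ one_ne_zero, gaussianReal_of_var_ne_zero _ one_ne_zero,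
    ← withDensity_mul _ (measurable_gaussianPDF _ _) (by fun_prop)]
  congr 1
  ext y
  simp only [gaussianPDF, gaussianPDFReal, Pi.mul_apply]
  rw [← ENNReal.ofReal_mul (by positivity), mul_assoc (√_)⁻¹, ← Real.exp_add]
  congr 3
  simp
  ring

theorem map_const_add_pi_gaussianReal (x : ι → ℝ) :
    (Measure.pi fun _ : ι => gaussianReal 0 1).map (fun z => x + z) =
      (Measure.pi fun _ : ι => gaussianReal 0 1).withDensity
        (fun y => ENNReal.ofReal (Real.exp (∑ j, x j * y j - ∑ j, x j ^ 2 / 2))) := by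
  have h1 : (Measure.pi fun _ : ι => gaussianReal 0 1).map (fun z => x + z) =
      Measure.pi fun j => gaussianReal (x j) 1 := by
    have : ∀ j, (gaussianReal 0 1).map (fun z => x j + z) = gaussianReal (x j) 1 := fun j => by
      rw [gaussianReal_map_const_add, zero_add]
    have hs : ∀ j, SigmaFinite ((gaussianReal 0 1).map (fun z => x j + z)) := fun j => by
      rw [this]; infer_instance
    have h := Measure.pi_map_pi (μ := fun _ : ι => gaussianReal 0 1) (f := fun j z => x j + z)
      (fun j => by fun_prop)
    simp_rw [this] at h
    exact h
  rw [h1]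
  refine Measure.pi_eq fun s hs => ?_
  rw [withDensity_apply _ (MeasurableSet.univ_pi hs), ← lintegral_indicator (MeasurableSet.univ_pi hs)]
  have hprod : ∀ y : ι → ℝ, (Set.univ.pi s).indicator
      (fun y => ENNReal.ofReal (Real.exp (∑ j, x j * y j - ∑ j, x j ^ 2 / 2))) y =
      ∏ j, (s j).indicator (fun y => ENNReal.ofReal (Real.exp (x j * y - x j ^ 2 / 2))) (y j) := by
    intro y
    by_cases hy : y ∈ Set.univ.pi s
    · rw [Set.indicator_of_mem hy, ← Finset.sum_sub_distrib, Real.exp_sum,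
        ENNReal.ofReal_prod_of_nonneg fun _ _ => (Real.exp_pos _).le]
      refine Finset.prod_congr rfl fun j _ => ?_
      rw [Set.indicator_of_mem (hy j trivial)]
    · rw [Set.indicator_of_notMem hy]
      simp only [Set.mem_univ_pi, not_forall] at hy
      obtain ⟨j, hj⟩ := hy
      exact (Finset.prod_eq_zero (Finset.mem_univ j) (Set.indicator_of_notMem hj _)).symm
  have hmeas : ∀ j, Measurable
      ((s j).indicator (fun y => ENNReal.ofReal (Real.exp (x j * y - x j ^ 2 / 2)))) := fun j =>
    Measurable.indicator (by fun_prop) (hs j)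
  simp_rw [hprod]
  -- Coordinates are independent under the product measure, so the integral of the product of
  -- one-variable densities factorizes.
  rw [lintegral_prod_eq_prod_lintegral_of_indepFun (μ := Measure.pi fun _ : ι => gaussianReal 0 1)
    Finset.univ
    (fun j y => (s j).indicator (fun y => ENNReal.ofReal (Real.exp (x j * y - x j ^ 2 / 2))) (y j))
    (iIndepFun_pi (μ := fun _ : ι => gaussianReal 0 1) fun j => (hmeas j).aemeasurable)
    (fun j => (hmeas j).comp (measurable_pi_apply j))]
  refine Finset.prod_congr rfl fun j _ => ?_
  rw [gaussianReal_eq_withDensity_exp (x j), withDensity_apply _ (hs j), ← lintegral_indicator (hs j)]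
  exact ((measurePreserving_eval (fun _ : ι => gaussianReal 0 1) j).lintegral_comp (hmeas j))

/-- Encoding two block sums as one linear functional with coefficients `a 1_A + b 1_D` reduces every
Gaussian moment below to a single product formula. -/
theorem sum_ite_mul_eq [DecidableEq ι] (a b : ℝ) (A D : Finset ι) (y : ι → ℝ) :
    ∑ j, ((if j ∈ A then a else 0) + (if j ∈ D then b else 0)) * y j =
      a * ∑ j ∈ A, y j + b * ∑ j ∈ D, y j := by
  simp [add_mul, Finset.sum_add_distrib, Finset.mul_sum, Finset.sum_ite_mem]

theorem sum_ite_sq_eq [DecidableEq ι] (a b : ℝ) (A D : Finset ι) :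
    ∑ j, ((if j ∈ A then a else 0) + (if j ∈ D then b else 0)) ^ 2 / 2 =
      (a ^ 2 * A.card + 2 * a * b * (A ∩ D).card + b ^ 2 * D.card) / 2 := by
  have h : ∀ j, ((if j ∈ A then a else 0) + (if j ∈ D then b else 0)) ^ 2 / 2 =
      (if j ∈ A then a ^ 2 / 2 else 0) + (if j ∈ A ∩ D then a * b else 0) +
        (if j ∈ D then b ^ 2 / 2 else 0) := by
    intro j
    by_cases h1 : j ∈ A <;> by_cases h2 : j ∈ D <;> (simp [h1, h2]; try ring)
  simp_rw [h, Finset.sum_add_distrib, Finset.sum_ite_mem, Finset.univ_inter, Finset.sum_const,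
    nsmul_eq_mul]
  ring

theorem integrable_exp_two_sums [DecidableEq ι] (a b r : ℝ) (A D : Finset ι) :
    Integrable (fun y : ι → ℝ => Real.exp (a * ∑ j ∈ A, y j + b * ∑ j ∈ D, y j + r))
      (Measure.pi fun _ => gaussianReal 0 1) := by
  simp_rw [Real.exp_add _ r, ← sum_ite_mul_eq]
  exact (integrable_exp_sum_mul_pi_gaussianReal _).mul_const _

theorem integral_exp_two_sums [DecidableEq ι] (a b r : ℝ) (A D : Finset ι) :
    ∫ y : ι → ℝ, Real.exp (a * ∑ j ∈ A, y j + b * ∑ j ∈ D, y j + r)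
      ∂(Measure.pi fun _ => gaussianReal 0 1) =
      Real.exp ((a ^ 2 * A.card + 2 * a * b * (A ∩ D).card + b ^ 2 * D.card) / 2 + r) := by
  simp_rw [Real.exp_add _ r, ← sum_ite_mul_eq]
  rw [integral_mul_const, integral_exp_sum_mul_pi_gaussianReal, sum_ite_sq_eq]

theorem integrable_shiftLikelihood (lam : ℝ) (A : Finset ι) :
    Integrable (shiftLikelihood lam A) (Measure.pi fun _ => gaussianReal 0 1) := by
  classical
  unfold shiftLikelihood
  simpa [sub_eq_add_neg] using
    integrable_exp_two_sums lam 0 (-(lam ^ 2 * A.card / 2)) A ∅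

theorem integral_shiftLikelihood (lam : ℝ) (A : Finset ι) :
    ∫ y, shiftLikelihood lam A y ∂(Measure.pi fun _ => gaussianReal 0 1) = 1 := by
  classical
  unfold shiftLikelihood
  have h := integral_exp_two_sums lam 0 (-(lam ^ 2 * A.card / 2)) A ∅
  have h0 : (lam ^ 2 * A.card + 2 * lam * 0 * (A ∩ ∅).card + 0 ^ 2 * (∅ : Finset ι).card) / 2 +
      -(lam ^ 2 * A.card / 2) = 0 := by simp
  rw [h0, Real.exp_zero] at h
  simpa [sub_eq_add_neg] using h

theorem integrable_truncatedLikelihood (lam K : ℝ) (A : Finset ι) (F : Finset (Finset ι)) :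
    Integrable (truncatedLikelihood lam K A F) (Measure.pi fun _ => gaussianReal 0 1) :=
  (integrable_shiftLikelihood lam A).indicator (measurableSet_scanEvent lam K F)

/-- Chernoff bound for the scan statistic of a subset `D` of the shifted set `A`. -/
theorem exists_scan_tail [DecidableEq ι] (lam : ℝ) {K : ℝ} (hK : 0 ≤ K) (A D : Finset ι)
    (hD : D ⊆ A) :
    ∃ g : (ι → ℝ) → ℝ, Integrable g (Measure.pi fun _ => gaussianReal 0 1) ∧ (∀ y, 0 ≤ g y) ∧
      (∀ y, scanThreshold lam K D.card < ∑ j ∈ D, y j → shiftLikelihood lam A y ≤ g y) ∧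
      ∫ y, g y ∂(Measure.pi fun _ => gaussianReal 0 1) ≤ Real.exp (-K) := by
  rcases D.eq_empty_or_nonempty with rfl | hne
  -- For empty `D` the sum and the threshold are both `0`, so the strict excess never occurs; the
  -- tilt used otherwise would divide by `D.card`.
  · refine ⟨0, integrable_zero _ _ _, fun _ => le_rfl, fun y hy => ?_, ?_⟩
    · simp [scanThreshold] at hy
    · simp [(Real.exp_pos _).le]
  · set N : ℝ := (D.card : ℝ) with hN
    have hNpos : 0 < N := by rw [hN]; exact_mod_cast hne.card_pos
    -- Optimal Chernoff tilt: under the shifted law the sum over `D` has mean `lam * N` and variance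
    -- `N`, and the excess to be beaten is `√(2NK)`, so the tilt is their quotient `√(2K/N)`.
    set θ := Real.sqrt (2 * K / N) with hθ
    set r := -(lam ^ 2 * A.card / 2) - θ * scanThreshold lam K D.card with hr
    refine ⟨fun y => Real.exp (lam * ∑ j ∈ A, y j + θ * ∑ j ∈ D, y j + r),
      integrable_exp_two_sums _ _ _ _ _, fun _ => (Real.exp_pos _).le, fun y hy => ?_, ?_⟩
    · refine Real.exp_le_exp.2 ?_
      have := mul_le_mul_of_nonneg_left hy.le (Real.sqrt_nonneg (2 * K / N))
      rw [hr, hθ]; linarith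
    · rw [integral_exp_two_sums]
      refine Real.exp_le_exp.2 ?_
      rw [Finset.inter_eq_right.2 hD, hr, scanThreshold, ← hN]
      have h1 : θ ^ 2 * N = 2 * K := by
        rw [hθ, Real.sq_sqrt (by positivity)]; field_simp
      have h2 : θ * Real.sqrt (2 * N * K) = 2 * K := by
        rw [hθ, ← Real.sqrt_mul (by positivity)]
        rw [show 2 * K / N * (2 * N * K) = (2 * K) ^ 2 by field_simp]
        exact Real.sqrt_sq (by positivity)
      rw [mul_add, h2]
      linarith

/-- Union bound: off the scan event some `D ∈ F` exceeds its threshold, so the likelihood ratio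
there is dominated by the sum of the Chernoff majorants, each of mass at most `exp (-K)`. -/
theorem integral_truncatedLikelihood_ge [DecidableEq ι] (lam : ℝ) {K : ℝ} (hK : 0 ≤ K)
    (A : Finset ι) (F : Finset (Finset ι)) (hF : ∀ D ∈ F, D ⊆ A) :
    1 - F.card * Real.exp (-K) ≤
      ∫ y, truncatedLikelihood lam K A F y ∂(Measure.pi fun _ => gaussianReal 0 1) := by
  have h : ∀ D : Finset ι, ∃ g : (ι → ℝ) → ℝ, D ∈ F →
      Integrable g (Measure.pi fun _ => gaussianReal 0 1) ∧ (∀ y, 0 ≤ g y) ∧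
      (∀ y, scanThreshold lam K D.card < ∑ j ∈ D, y j → shiftLikelihood lam A y ≤ g y) ∧
      ∫ y, g y ∂(Measure.pi fun _ => gaussianReal 0 1) ≤ Real.exp (-K) := fun D => by
    by_cases hD : D ∈ F
    · obtain ⟨g, hg⟩ := exists_scan_tail lam hK A D (hF D hD)
      exact ⟨g, fun _ => hg⟩
    · exact ⟨0, fun h => absurd h hD⟩
  choose g hg using h
  have hint : Integrable (fun y => ∑ D ∈ F, g D y) (Measure.pi fun _ => gaussianReal 0 1) :=
    integrable_finsetSum _ fun D hD => (hg D hD).1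
  calc 1 - F.card * Real.exp (-K)
      ≤ 1 - ∑ D ∈ F, ∫ y, g D y ∂(Measure.pi fun _ => gaussianReal 0 1) := by
        have := Finset.sum_le_card_nsmul F
          (fun D => ∫ y, g D y ∂(Measure.pi fun _ => gaussianReal 0 1)) (Real.exp (-K))
          fun D hD => (hg D hD).2.2.2
        rw [nsmul_eq_mul] at this
        linarith
    _ = ∫ y, (shiftLikelihood lam A y - ∑ D ∈ F, g D y)
          ∂(Measure.pi fun _ => gaussianReal 0 1) := by
        rw [integral_sub (integrable_shiftLikelihood lam A) hint, integral_shiftLikelihood,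
          integral_finsetSum _ fun D hD => (hg D hD).1]
    _ ≤ _ := by
        refine integral_mono ((integrable_shiftLikelihood lam A).sub hint)
          (integrable_truncatedLikelihood lam K A F) fun y => ?_
        by_cases hy : y ∈ scanEvent lam K F
        · rw [truncatedLikelihood, Set.indicator_of_mem hy]
          have := Finset.sum_nonneg fun D hD => (hg D hD).2.1 y
          dsimp only
          linarith
        · rw [truncatedLikelihood, Set.indicator_of_notMem hy]
          simp only [scanEvent, Set.mem_ofPred_eq, not_forall, not_le] at hy
          obtain ⟨D, hD, hlt⟩ := hy
          have h1 := (hg D hD).2.2.1 y hlt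
          have h2 := Finset.single_le_sum (f := fun D => g D y)
            (fun D hD => (hg D hD).2.1 y) hD
          dsimp only at h2 ⊢
          linarith

theorem integrable_truncatedLikelihood_mul (lam K : ℝ) (A B : Finset ι)
    (F G : Finset (Finset ι)) :
    Integrable (fun y => truncatedLikelihood lam K A F y * truncatedLikelihood lam K B G y)
      (Measure.pi fun _ => gaussianReal 0 1) := by
  classical
  refine (integrable_exp_two_sums lam lam (-(lam ^ 2 * A.card / 2) - lam ^ 2 * B.card / 2)
    A B).mono' ((measurable_truncatedLikelihood lam K A F).mul
      (measurable_truncatedLikelihood lam K B G)).aestronglyMeasurable (ae_of_all _ fun y => ?_)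
  rw [← shiftLikelihood_mul, Real.norm_of_nonneg (mul_nonneg (truncatedLikelihood_nonneg _ _ _ _ _)
    (truncatedLikelihood_nonneg _ _ _ _ _))]
  exact mul_le_mul (truncatedLikelihood_le _ _ _ _ _) (truncatedLikelihood_le _ _ _ _ _)
    (truncatedLikelihood_nonneg _ _ _ _ _) (Real.exp_pos _).le

/-- The first bound drops the truncation. For the second, write the sum over `A` plus the sum over
`B` as the sum over `A ∪ B` plus the sum over `A ∩ B`. The scan event caps the last one, and only
the Gaussian moment of the union remains. A cap for `A` alone suffices. -/
theorem integral_truncatedLikelihood_mul_le [DecidableEq ι] {lam : ℝ} (hlam : 0 ≤ lam) (K : ℝ)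
    (A B : Finset ι) (F G : Finset (Finset ι)) (hF : A ∩ B ∈ F) :
    ∫ y, truncatedLikelihood lam K A F y * truncatedLikelihood lam K B G y
        ∂(Measure.pi fun _ => gaussianReal 0 1) ≤
      Real.exp (min (lam ^ 2 * (A ∩ B).card)
        (lam ^ 2 * (A ∩ B).card / 2 + lam * Real.sqrt (2 * (A ∩ B).card * K))) := by
  have hle : ∀ y, truncatedLikelihood lam K A F y * truncatedLikelihood lam K B G y ≤
      shiftLikelihood lam A y * shiftLikelihood lam B y := fun y =>
    mul_le_mul (truncatedLikelihood_le _ _ _ _ _) (truncatedLikelihood_le _ _ _ _ _)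
      (truncatedLikelihood_nonneg _ _ _ _ _) (Real.exp_pos _).le
  rw [Real.exp_monotone.map_min]
  refine le_min ?_ ?_
  · calc _ ≤ ∫ y, shiftLikelihood lam A y * shiftLikelihood lam B y
          ∂(Measure.pi fun _ => gaussianReal 0 1) := by
          refine integral_mono (integrable_truncatedLikelihood_mul _ _ _ _ _ _) ?_ hle
          simp_rw [shiftLikelihood_mul]
          exact integrable_exp_two_sums _ _ _ _ _
      _ = _ := by
          simp_rw [shiftLikelihood_mul]
          rw [integral_exp_two_sums]
          congr 1; ring
  · set T := scanThreshold lam K (A ∩ B).card with hT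
    set r := -(lam ^ 2 * A.card / 2) - lam ^ 2 * B.card / 2 + lam * T with hr
    calc _ ≤ ∫ y : ι → ℝ, Real.exp (lam * ∑ j ∈ A ∪ B, y j + 0 * ∑ j ∈ (∅ : Finset ι), y j + r)
          ∂(Measure.pi fun _ => gaussianReal 0 1) := by
          refine integral_mono (integrable_truncatedLikelihood_mul _ _ _ _ _ _)
            (integrable_exp_two_sums _ _ _ _ _) fun y => ?_
          by_cases hy : y ∈ scanEvent lam K F
          · refine (hle y).trans ?_
            rw [shiftLikelihood_mul]
            refine Real.exp_le_exp.2 ?_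
            have h1 : ∑ j ∈ A ∪ B, y j = ∑ j ∈ A, y j + ∑ j ∈ B, y j - ∑ j ∈ A ∩ B, y j := by
              rw [← Finset.sum_union_inter]; ring
            have h2 := mul_le_mul_of_nonneg_left (hy _ hF) hlam
            rw [h1, hr, hT]
            linarith
          · dsimp only
            rw [truncatedLikelihood, Set.indicator_of_notMem hy, zero_mul]
            exact (Real.exp_pos _).le
      _ = _ := by
          rw [integral_exp_two_sums]
          have h1 : ((A ∪ B).card : ℝ) = A.card + B.card - (A ∩ B).card := by
            have := Finset.card_union_add_card_inter A B
            rw [eq_sub_iff_add_eq]; exact_mod_cast this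
          rw [hr, hT, scanThreshold, h1]
          congr 1
          simp
          ring

end Gaussian

/-! ### From truncated moments to a lower bound on the error sum. -/

section Bayes

variable {Ω κ : Type*} [MeasurableSpace Ω]

/-- Truncated second moment method: if the average of the truncated likelihood ratios has first and
second moments close to `1`, then no set separates the null from the mixture. -/
theorem error_sum_ge_of_truncated_moments (Q : Measure Ω) [IsProbabilityMeasure Q] (S : Finset κ)
    (hS : S.Nonempty) (ℓ f : κ → Ω → ℝ) (hℓ : ∀ I ∈ S, Measurable (ℓ I))
    (hf0 : ∀ I ∈ S, ∀ ω, 0 ≤ f I ω) (hfℓ : ∀ I ∈ S, ∀ ω, f I ω ≤ ℓ I ω)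
    (hfi : ∀ I ∈ S, Integrable (f I) Q)
    (hfii : ∀ I ∈ S, ∀ J ∈ S, Integrable (fun ω => f I ω * f J ω) Q)
    {s t : ℝ} (ht : 0 < t)
    (h1 : ∀ I ∈ S, 1 - s ≤ ∫ ω, f I ω ∂Q)
    (h2 : ∀ I ∈ S, ∑ J ∈ S, ∫ ω, f I ω * f J ω ∂Q ≤ (1 + s) * S.card)
    {A : Set Ω} (hA : MeasurableSet A) (b : ℝ≥0∞)
    (hb : ∀ I ∈ S, (Q.withDensity fun ω => ENNReal.ofReal (ℓ I ω)) Aᶜ ≤ b) :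
    ENNReal.ofReal (1 - t - 3 * s / (4 * t)) ≤ Q A + b := by
  set M : ℝ := (S.card : ℝ) with hM
  have hMpos : 0 < M := by rw [hM]; exact_mod_cast hS.card_pos
  set g : Ω → ℝ := fun ω => M⁻¹ * ∑ I ∈ S, f I ω with hg
  have hgi : Integrable g Q := (integrable_finsetSum _ hfi).const_mul _
  have hg0 : ∀ ω, 0 ≤ g ω := fun ω =>
    mul_nonneg (by positivity) (Finset.sum_nonneg fun I hI => hf0 I hI ω)
  have hgg : ∀ ω, g ω ^ 2 = M⁻¹ ^ 2 * ∑ I ∈ S, ∑ J ∈ S, f I ω * f J ω := fun ω => by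
    rw [hg, mul_pow, ← Finset.sum_mul_sum, sq (∑ I ∈ S, f I ω)]
  have hggi : Integrable (fun ω => g ω ^ 2) Q := by
    simp_rw [hgg]
    exact (integrable_finsetSum _ fun I hI => integrable_finsetSum _ (hfii I hI)).const_mul _
  have hm1 : 1 - s ≤ ∫ ω, g ω ∂Q := by
    rw [hg, integral_const_mul, integral_finsetSum _ hfi, le_inv_mul_iff₀ hMpos]
    have := Finset.card_nsmul_le_sum S _ _ h1
    rwa [nsmul_eq_mul] at this
  have hm2 : ∫ ω, g ω ^ 2 ∂Q ≤ 1 + s := by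
    simp_rw [hgg]
    rw [integral_const_mul,
      integral_finsetSum _ fun I hI => integrable_finsetSum _ (hfii I hI)]
    have : ∑ I ∈ S, ∫ ω, ∑ J ∈ S, f I ω * f J ω ∂Q ≤ M * ((1 + s) * M) := by
      have h := Finset.sum_le_card_nsmul S (fun I => ∫ ω, ∑ J ∈ S, f I ω * f J ω ∂Q)
        ((1 + s) * M) fun I hI => by
          rw [integral_finsetSum _ (hfii I hI)]; exact h2 I hI
      rwa [nsmul_eq_mul] at h
    calc _ ≤ M⁻¹ ^ 2 * (M * ((1 + s) * M)) := by gcongr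
      _ = 1 + s := by field_simp
  -- `min 1 x ≥ 1 - |1 - x|`, and by AM-GM `|1 - x| ≤ t + (1 - x)² / (4t)`. Integrating at `x = g`
  -- uses `1 - 2(1 - s) + (1 + s) = 3s`.
  have hpt : ∀ x : ℝ, 1 - t - (1 - 2 * x + x ^ 2) / (4 * t) ≤ min 1 x := fun x => by
    have h : t + (1 - 2 * x + x ^ 2) / (4 * t) - |1 - x| = (2 * t - |1 - x|) ^ 2 / (4 * t) := by
      rw [show 1 - 2 * x + x ^ 2 = |1 - x| ^ 2 by rw [sq_abs]; ring]
      field_simp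
      ring
    have h' : 0 ≤ (2 * t - |1 - x|) ^ 2 / (4 * t) := by positivity
    refine le_min ?_ ?_
    · linarith [abs_nonneg (1 - x)]
    · linarith [le_abs_self (1 - x)]
  have hmini : Integrable (fun ω => min 1 (g ω)) Q := (integrable_const 1).inf hgi
  have hlow : 1 - t - 3 * s / (4 * t) ≤ ∫ ω, min 1 (g ω) ∂Q := by
    have hi1 : Integrable (fun ω => 1 - 2 * g ω) Q := (integrable_const 1).sub (hgi.const_mul 2)
    have hi2 : Integrable (fun ω => 1 - 2 * g ω + g ω ^ 2) Q :=
      hi1.add hggi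
    calc 1 - t - 3 * s / (4 * t)
        ≤ 1 - t - (1 - 2 * ∫ ω, g ω ∂Q + ∫ ω, g ω ^ 2 ∂Q) / (4 * t) := by
          gcongr; linarith
      _ = ∫ ω, (1 - t - (1 - 2 * g ω + g ω ^ 2) / (4 * t)) ∂Q := by
          rw [integral_sub (integrable_const _) (hi2.div_const _), integral_div,
            integral_add hi1 hggi,
            integral_sub (integrable_const 1) (hgi.const_mul 2), integral_const_mul 2 g]
          simp
      _ ≤ _ := integral_mono ((integrable_const _).sub (hi2.div_const _)) hmini fun ω => hpt _
  -- The average of the `f I` is dominated by the mixture density, so its mass on `Aᶜ` is at most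
  -- the average type II error, hence at most `b`.
  have hlint : ∫⁻ ω in Aᶜ, ENNReal.ofReal (g ω) ∂Q ≤ b := by
    have hmul : ENNReal.ofReal M * ∫⁻ ω in Aᶜ, ENNReal.ofReal (g ω) ∂Q ≤ ENNReal.ofReal M * b := by
      calc ENNReal.ofReal M * ∫⁻ ω in Aᶜ, ENNReal.ofReal (g ω) ∂Q
          = ∫⁻ ω in Aᶜ, ENNReal.ofReal M * ENNReal.ofReal (g ω) ∂Q :=
            (lintegral_const_mul' _ _ ENNReal.ofReal_ne_top).symm
        _ ≤ ∫⁻ ω in Aᶜ, ∑ I ∈ S, ENNReal.ofReal (ℓ I ω) ∂Q := by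
            refine lintegral_mono fun ω => ?_
            rw [← ENNReal.ofReal_mul hMpos.le, hg]
            rw [mul_inv_cancel_left₀ hMpos.ne', ENNReal.ofReal_sum_of_nonneg fun I hI => hf0 I hI ω]
            exact Finset.sum_le_sum fun I hI => ENNReal.ofReal_le_ofReal (hfℓ I hI ω)
        _ = ∑ I ∈ S, ∫⁻ ω in Aᶜ, ENNReal.ofReal (ℓ I ω) ∂Q :=
            lintegral_finsetSum' _ fun I hI => (hℓ I hI).ennreal_ofReal.aemeasurable
        _ ≤ ∑ I ∈ S, b := Finset.sum_le_sum fun I hI => by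
            rw [← withDensity_apply _ hA.compl]; exact hb I hI
        _ = ENNReal.ofReal M * b := by
            rw [Finset.sum_const, nsmul_eq_mul, hM, ENNReal.ofReal_natCast]
    rwa [ENNReal.mul_le_mul_iff_right (by simpa using hMpos) ENNReal.ofReal_ne_top] at hmul
  calc ENNReal.ofReal (1 - t - 3 * s / (4 * t))
      ≤ ENNReal.ofReal (∫ ω, min 1 (g ω) ∂Q) := ENNReal.ofReal_le_ofReal hlow
    _ = ∫⁻ ω, ENNReal.ofReal (min 1 (g ω)) ∂Q :=
        ofReal_integral_eq_lintegral_ofReal hmini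
          (ae_of_all _ fun ω => le_min zero_le_one (hg0 ω))
    _ = ∫⁻ ω in A, ENNReal.ofReal (min 1 (g ω)) ∂Q +
          ∫⁻ ω in Aᶜ, ENNReal.ofReal (min 1 (g ω)) ∂Q := (lintegral_add_compl _ hA).symm
    _ ≤ Q A + b := by
        refine add_le_add ?_ ?_
        · calc _ ≤ ∫⁻ _ in A, 1 ∂Q := lintegral_mono fun ω => by simp
            _ = Q A := by simp
        · exact (lintegral_mono fun ω => ENNReal.ofReal_le_ofReal (min_le_right _ _)).trans hlint

end Bayes

/-! ### Hypergeometric overlaps and exponential sums over boxes. -/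

section Overlap

theorem card_powersetCard_filter_subset_le {N : ℕ} (k : ℕ) (D : Finset (Fin N)) :
    ((Finset.univ.powersetCard k).filter fun J : Finset (Fin N) => D ⊆ J).card ≤
      (N - D.card).choose (k - D.card) := by
  have hcard : (Dᶜ.powersetCard (k - D.card)).card = (N - D.card).choose (k - D.card) := by
    rw [Finset.card_powersetCard, Finset.card_compl, Fintype.card_fin]
  rw [← hcard]
  refine Finset.card_le_card_of_injOn (fun J => J \ D) (fun J hJ => ?_) fun J hJ J' hJ' h => ?_
  · simp only [Finset.coe_filter, Finset.mem_powersetCard, Set.mem_ofPred_eq] at hJ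
    rw [Finset.mem_coe, Finset.mem_powersetCard]
    refine ⟨fun x hx => by simpa using (Finset.mem_sdiff.1 hx).2, ?_⟩
    rw [Finset.card_sdiff_of_subset hJ.2, hJ.1.2]
  · simp only [Finset.coe_filter, Finset.mem_powersetCard, Set.mem_ofPred_eq] at hJ hJ'
    rw [← Finset.sdiff_union_of_subset hJ.2, ← Finset.sdiff_union_of_subset hJ'.2]
    exact congrArg (· ∪ D) h

/-- The ratio of binomials is `∏ (k - i) / (n - i)` over `i < h`, and each factor is at most `k / n`
because `k ≤ n`. -/
theorem choose_sub_sub_mul_pow_le {n k : ℕ} (hkn : k ≤ n) {h : ℕ} (hh : h ≤ k) :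
    (n - h).choose (k - h) * n ^ h ≤ n.choose k * k ^ h := by
  induction h with
  | zero => simp
  | succ h ih =>
    have ih := ih (by omega)
    obtain ⟨a, ha⟩ : ∃ a, n - h = a + 1 := ⟨n - h - 1, by omega⟩
    obtain ⟨b, hb⟩ : ∃ b, k - h = b + 1 := ⟨k - h - 1, by omega⟩
    rw [ha, hb] at ih
    rw [show n - (h + 1) = a by omega, show k - (h + 1) = b by omega]
    have h1 : (a + 1) * a.choose b = (a + 1).choose (b + 1) * (b + 1) :=
      Nat.add_one_mul_choose_eq a b
    have h2 : a.choose b * n ≤ (a + 1).choose (b + 1) * k := by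
      have h3 : (b + 1) * n ≤ (a + 1) * k := by
        rw [show n = a + 1 + h by omega, show k = b + 1 + h by omega]
        have : b ≤ a := by omega
        nlinarith
      refine Nat.le_of_mul_le_mul_left ?_ (Nat.succ_pos a)
      calc (a + 1) * (a.choose b * n) = (a + 1).choose (b + 1) * ((b + 1) * n) := by
            rw [← mul_assoc, h1, mul_assoc]
        _ ≤ (a + 1).choose (b + 1) * ((a + 1) * k) := Nat.mul_le_mul_left _ h3
        _ = _ := by rw [Nat.succ_eq_add_one]; ring
    calc a.choose b * n ^ (h + 1) = a.choose b * n * n ^ h := by ring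
      _ ≤ (a + 1).choose (b + 1) * k * n ^ h := Nat.mul_le_mul_right _ h2
      _ = (a + 1).choose (b + 1) * n ^ h * k := by ring
      _ ≤ n.choose k * k ^ h * k := Nat.mul_le_mul_right _ ih
      _ = _ := by ring

/-- Combines `k.choose h ≤ k ^ h / h!` with `h ^ h / h! ≤ e ^ h`, one term of the exponential
series. -/
theorem choose_le_exp_mul_div_pow (k h : ℕ) :
    (k.choose h : ℝ) ≤ (Real.exp 1 * k / h) ^ h := by
  rcases Nat.eq_zero_or_pos h with rfl | hpos
  · simp
  have h1 : (k.choose h : ℝ) ≤ (k : ℝ) ^ h / h.factorial := Nat.choose_le_pow_div h k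
  have h2 := Real.pow_div_factorial_le_exp (x := (h : ℝ)) (by positivity) h
  have hp : (0 : ℝ) < (h : ℝ) ^ h := by positivity
  have hf : (0 : ℝ) < h.factorial := by positivity
  calc (k.choose h : ℝ) ≤ (k : ℝ) ^ h / h.factorial := h1
    _ = (k : ℝ) ^ h / (h : ℝ) ^ h * ((h : ℝ) ^ h / h.factorial) := by field_simp
    _ ≤ (k : ℝ) ^ h / (h : ℝ) ^ h * Real.exp h := by gcongr
    _ = (Real.exp 1 * k / h) ^ h := by
      rw [div_pow, mul_pow, ← Real.exp_nat_mul, mul_one]; ring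

/-- Upper tail bound for the point probabilities of the overlap of two `k`-subsets. -/
theorem card_overlap_eq_le {N k : ℕ} (hk : k ≤ N) {I : Finset (Fin N)} (hI : I.card = k) {h : ℕ}
    (hh : 1 ≤ h) :
    (((Finset.univ.powersetCard k).filter fun J => (I ∩ J).card = h).card : ℝ) ≤
      N.choose k * (Real.exp 1 * k / h * (k / N)) ^ h := by
  rcases lt_or_ge k h with hlt | hle
  · have : (Finset.univ.powersetCard k).filter (fun J : Finset (Fin N) => (I ∩ J).card = h) = ∅ := by
      refine Finset.filter_eq_empty_iff.2 fun J _ hJ => ?_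
      have := Finset.card_le_card (Finset.inter_subset_left (s₁ := I) (s₂ := J))
      omega
    rw [this]; simp; positivity
  · have hN : (0 : ℝ) < N := by exact_mod_cast (by omega : 0 < N)
    have hnat : ((Finset.univ.powersetCard k).filter fun J => (I ∩ J).card = h).card ≤
        k.choose h * (N - h).choose (k - h) := by
      calc _ ≤ ((I.powersetCard h).biUnion fun D =>
            (Finset.univ.powersetCard k).filter fun J : Finset (Fin N) => D ⊆ J).card := by
            refine Finset.card_le_card fun J hJ => ?_
            rw [Finset.mem_filter] at hJ
            rw [Finset.mem_biUnion]
            exact ⟨I ∩ J, Finset.mem_powersetCard.2 ⟨Finset.inter_subset_left, hJ.2⟩,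
              Finset.mem_filter.2 ⟨hJ.1, Finset.inter_subset_right⟩⟩
        _ ≤ (I.powersetCard h).card * (N - h).choose (k - h) := by
            refine Finset.card_biUnion_le_card_mul _ _ _ fun D hD => ?_
            have h1 := card_powersetCard_filter_subset_le k D
            rwa [(Finset.mem_powersetCard.1 hD).2] at h1
        _ = _ := by rw [Finset.card_powersetCard, hI]
    have h2 : ((N - h).choose (k - h) : ℝ) ≤ N.choose k * (k / N : ℝ) ^ h := by
      rw [div_pow, ← mul_div_assoc, le_div_iff₀ (by positivity)]
      exact_mod_cast choose_sub_sub_mul_pow_le hk hle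
    calc _ ≤ (k.choose h : ℝ) * (N - h).choose (k - h) := by exact_mod_cast hnat
      _ ≤ (Real.exp 1 * k / h) ^ h * (N.choose k * (k / N : ℝ) ^ h) := by
          gcongr
          exact choose_le_exp_mul_div_pow k h
      _ = _ := by rw [mul_pow (Real.exp 1 * k / h)]; ring

/-- Group the sets `J` by overlap size. Since `g 0 = 0`, the geometric series starts at `h = 1`,
which produces the small factor `r / (1 - r)`. -/
theorem sum_overlap_le {N k : ℕ} (hk : k ≤ N) {I : Finset (Fin N)} (hI : I.card = k)
    {g : ℕ → ℝ} (hg0 : g 0 = 0) {r : ℝ} (hr0 : 0 ≤ r) (hr1 : r < 1) {C : ℝ} (hC : 0 ≤ C)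
    (hg : ∀ h, 0 ≤ g h)
    (hgr : ∀ h, 1 ≤ h → h ≤ k → (Real.exp 1 * k / h * (k / N)) ^ h * g h ≤ C * r ^ h) :
    ∑ J ∈ Finset.univ.powersetCard k, g (I ∩ J).card ≤ N.choose k * (C * (r / (1 - r))) := by
  have hmaps : ∀ J ∈ (Finset.univ : Finset (Fin N)).powersetCard k,
      (I ∩ J).card ∈ Finset.range (k + 1) := fun J _ => by
    rw [Finset.mem_range, Nat.lt_succ_iff, ← hI]
    exact Finset.card_le_card Finset.inter_subset_left
  rw [← Finset.sum_fiberwise_of_maps_to hmaps, Finset.sum_range_succ']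
  have hz : ∑ J ∈ (Finset.univ : Finset (Fin N)).powersetCard k with (I ∩ J).card = 0,
      g (I ∩ J).card = 0 :=
    Finset.sum_eq_zero fun J hJ => by rw [(Finset.mem_filter.1 hJ).2, hg0]
  rw [hz, add_zero]
  calc _ ≤ ∑ h ∈ Finset.range k, N.choose k * (C * r ^ (h + 1)) := by
        refine Finset.sum_le_sum fun h hh => ?_
        have h1 : ∑ J ∈ (Finset.univ : Finset (Fin N)).powersetCard k with (I ∩ J).card = h + 1,
            g (I ∩ J).card = ((Finset.univ.powersetCard k).filter
              fun J : Finset (Fin N) => (I ∩ J).card = h + 1).card * g (h + 1) := by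
          rw [← nsmul_eq_mul, ← Finset.sum_const]
          exact Finset.sum_congr rfl fun J hJ => by rw [(Finset.mem_filter.1 hJ).2]
        rw [h1]
        calc _ ≤ N.choose k * (Real.exp 1 * k / (h + 1 : ℕ) * (k / N)) ^ (h + 1) * g (h + 1) :=
              mul_le_mul_of_nonneg_right (card_overlap_eq_le hk hI (by omega)) (hg _)
          _ ≤ _ := by
              rw [mul_assoc]
              exact mul_le_mul_of_nonneg_left (hgr (h + 1) (by omega)
                (by have := Finset.mem_range.1 hh; omega)) (by positivity)
    _ = N.choose k * (C * (r * ∑ h ∈ Finset.range k, r ^ h)) := by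
        simp_rw [pow_succ']
        rw [← Finset.mul_sum, ← Finset.mul_sum, ← Finset.mul_sum]
    _ ≤ _ := by
        have h2 : ∑ h ∈ Finset.range k, r ^ h ≤ 1 / (1 - r) := by
          rw [one_div, ← tsum_geometric_of_lt_one hr0 hr1]
          exact (summable_geometric_of_lt_one hr0 hr1).sum_le_tsum _ fun _ _ => by positivity
        have : r / (1 - r) = r * (1 / (1 - r)) := by ring
        rw [this]
        gcongr

/-- The exponent weight of an overlap that exceeds its mean by a constant factor. -/
noncomputable def largeOverlapWeight (η : ℝ) (N k h : ℕ) : ℝ :=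
  if Real.exp 2 * (k * (k / N)) ≤ (h : ℝ) then η * h else 0

/-- Above `e²` times the mean, an overlap `h` has probability at most `e ^ (-h)`. Since `e ^ (ηh) -
1 ≤ ηh e ^ (ηh) ≤ 4η e ^ (h/2)`, the excess over `1` is at most `4η ∑ e ^ (-h/2) ≤ 8η`. -/
theorem sum_exp_largeOverlapWeight_le {N k : ℕ} (hk : k ≤ N) {I : Finset (Fin N)}
    (hI : I.card = k) {η : ℝ} (hη : 0 ≤ η) (hη' : η ≤ 1 / 4) :
    ∑ J ∈ Finset.univ.powersetCard k, Real.exp (largeOverlapWeight η N k (I ∩ J).card) ≤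
      N.choose k * (1 + 8 * η) := by
  have hw : ∀ h, 0 ≤ largeOverlapWeight η N k h := fun h => by
    unfold largeOverlapWeight; split_ifs <;> positivity
  have hexp : Real.exp (-(1 / 2)) ≤ 2 / 3 := by
    have := Real.add_one_le_exp (1 / 2 : ℝ)
    rw [Real.exp_neg, inv_le_comm₀ (Real.exp_pos _) (by norm_num)]; linarith
  have hr : Real.exp (-(1 / 2)) / (1 - Real.exp (-(1 / 2))) ≤ 2 := by
    rw [div_le_iff₀ (by linarith)]; linarith
  have hr1 : Real.exp (-(1 / 2)) < 1 := by linarith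
  have hsum := sum_overlap_le hk hI (g := fun h => Real.exp (largeOverlapWeight η N k h) - 1)
    (r := Real.exp (-(1 / 2))) (C := 4 * η) (by simp [largeOverlapWeight]) (Real.exp_pos _).le
    hr1 (by positivity)
    (fun h => by have := Real.add_one_le_exp (largeOverlapWeight η N k h); linarith [hw h])
    (fun h h1 hhk => by
      by_cases hc : Real.exp 2 * (k * (k / N)) ≤ (h : ℝ)
      · have hpos : (0 : ℝ) < h := by exact_mod_cast h1
        have hp : (Real.exp 1 * k / h * (k / N)) ^ h ≤ Real.exp (-h) := by
          have : Real.exp 1 * k / h * (k / N) ≤ Real.exp (-1) := by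
            rw [show Real.exp 1 * k / h * (k / N) = Real.exp 1 * (k * (k / N)) / h by ring,
              div_le_iff₀ hpos]
            rw [show (2 : ℝ) = 1 + 1 by norm_num, Real.exp_add, mul_assoc] at hc
            calc _ = Real.exp (-1) * (Real.exp 1 * (Real.exp 1 * (k * (k / N)))) := by
                  rw [← mul_assoc (Real.exp (-1)), ← Real.exp_add]; simp
              _ ≤ _ := by gcongr
          calc _ ≤ Real.exp (-1) ^ h := pow_le_pow_left₀ (by positivity) this h
            _ = _ := by rw [← Real.exp_nat_mul]; ring_nf
        have hq : Real.exp (largeOverlapWeight η N k h) - 1 ≤ 4 * η * Real.exp (h / 2) := by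
          rw [largeOverlapWeight, if_pos hc]
          have e1 : Real.exp (η * h) - 1 ≤ η * h * Real.exp (η * h) := by
            have h3 := Real.add_one_le_exp (-(η * h))
            have h4 : Real.exp (-(η * h)) * Real.exp (η * h) = 1 := by
              rw [← Real.exp_add]; simp
            nlinarith [Real.exp_pos (η * h)]
          have e2 : (h : ℝ) ≤ 4 * Real.exp (h / 4) := by
            have := Real.add_one_le_exp (h / 4 : ℝ); linarith
          have e3 : Real.exp (η * h) ≤ Real.exp (h / 4) := Real.exp_le_exp.2 (by nlinarith)
          calc _ ≤ η * h * Real.exp (η * h) := e1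
            _ ≤ η * (4 * Real.exp (h / 4)) * Real.exp (h / 4) := by gcongr
            _ = 4 * η * (Real.exp (h / 4) * Real.exp (h / 4)) := by ring
            _ = _ := by rw [← Real.exp_add]; ring_nf
        calc _ ≤ Real.exp (-h) * (4 * η * Real.exp (h / 2)) := by
              refine mul_le_mul hp hq ?_ (Real.exp_pos _).le
              have := Real.add_one_le_exp (largeOverlapWeight η N k h); linarith [hw h]
          _ = 4 * η * (Real.exp (-h) * Real.exp (h / 2)) := by ring
          _ = 4 * η * Real.exp (-(1 / 2)) ^ h := by
              rw [← Real.exp_add, ← Real.exp_nat_mul]; ring_nf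
      · rw [largeOverlapWeight, if_neg hc]; simp; positivity)
  rw [Finset.sum_sub_distrib, Finset.sum_const, Finset.card_powersetCard, Finset.card_univ,
    Fintype.card_fin, nsmul_eq_mul, mul_one] at hsum
  have : (N.choose k : ℝ) * (4 * η * (Real.exp (-(1 / 2)) / (1 - Real.exp (-(1 / 2))))) ≤
      N.choose k * (4 * η * 2) := by gcongr
  linarith

/-- The weight of an overlap `h` that is nearly of the order of `k`. -/
noncomputable def nearFullWeight (γ δ L : ℝ) (k h : ℕ) : ℝ :=
  if k * Real.exp (-(δ * L)) < (h : ℝ) then Real.exp (γ * (h * L)) else 0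

theorem nearFullWeight_nonneg (γ δ L : ℝ) (k h : ℕ) : 0 ≤ nearFullWeight γ δ L k h := by
  unfold nearFullWeight; split_ifs <;> positivity

/-- With `h > k e ^ (-δL)` the point probability is at most `e ^ (-(1 - 2δ) L h)`: one `δ` pays for
`k / h`, the other for the factor `e` through `1 ≤ δ * L`. Against the weight `e ^ (γ h L)` this
leaves a geometric series in `e ^ (-(1 - 2δ - γ) L)`. -/
theorem sum_nearFullWeight_le {N k : ℕ} (hk : k ≤ N) (hk0 : 0 < k) {I : Finset (Fin N)}
    (hI : I.card = k) {γ δ L : ℝ} (hL : L = Real.log (N / k)) (hδL : 1 ≤ δ * L)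
    (hx : Real.exp (-((1 - 2 * δ - γ) * L)) ≤ 1 / 2) :
    ∑ J ∈ Finset.univ.powersetCard k, nearFullWeight γ δ L k (I ∩ J).card ≤
      N.choose k * (2 * Real.exp (-((1 - 2 * δ - γ) * L))) := by
  set x := Real.exp (-((1 - 2 * δ - γ) * L)) with hxdef
  have hx0 : 0 ≤ x := (Real.exp_pos _).le
  have hkR : (0 : ℝ) < k := by exact_mod_cast hk0
  have hNR : (0 : ℝ) < N := by exact_mod_cast hk0.trans_le hk
  have hkN : (k / N : ℝ) = Real.exp (-L) := by
    rw [hL, Real.exp_neg, Real.exp_log (by positivity), inv_div]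
  refine (sum_overlap_le hk hI (g := nearFullWeight γ δ L k) (r := x) (C := 1) ?_ hx0
    (by linarith) zero_le_one (nearFullWeight_nonneg γ δ L k) fun h h1 hhk => ?_).trans ?_
  · rw [nearFullWeight, if_neg]
    push_cast; exact not_lt.2 (by positivity)
  · rw [one_mul, nearFullWeight]
    split_ifs with hc
    · have hpos : (0 : ℝ) < h := by exact_mod_cast h1
      have hb : Real.exp 1 * k / h * (k / N) ≤ Real.exp (-((1 - 2 * δ) * L)) := by
        have hkh : (k : ℝ) / h ≤ Real.exp (δ * L) := by
          rw [div_le_iff₀ hpos]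
          calc (k : ℝ) = Real.exp (δ * L) * (k * Real.exp (-(δ * L))) := by
                rw [mul_left_comm, ← Real.exp_add]; simp
            _ ≤ _ := by gcongr
        rw [hkN]
        calc Real.exp 1 * k / h * Real.exp (-L) = Real.exp 1 * (k / h) * Real.exp (-L) := by ring
          _ ≤ Real.exp (δ * L) * Real.exp (δ * L) * Real.exp (-L) := by gcongr
          _ = _ := by rw [← Real.exp_add, ← Real.exp_add]; ring_nf
      calc _ ≤ Real.exp (-((1 - 2 * δ) * L)) ^ h * Real.exp (γ * (h * L)) := by gcongr
        _ = x ^ h := by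
          rw [hxdef, ← Real.exp_nat_mul, ← Real.exp_nat_mul, ← Real.exp_add]; ring_nf
    · rw [mul_zero]; positivity
  · refine mul_le_mul_of_nonneg_left ?_ (by positivity)
    rw [one_mul, div_le_iff₀ (by linarith)]
    nlinarith

/-- The boxes with side lengths `k`. -/
def clusterBoxes {d : ℕ} (k n : Fin d → ℕ) : Finset (∀ i, Finset (Fin (n i))) :=
  Fintype.piFinset fun i => Finset.univ.powersetCard (k i)

theorem mem_clusterBoxes {d : ℕ} {k n : Fin d → ℕ} {I : ∀ i, Finset (Fin (n i))} :
    I ∈ clusterBoxes k n ↔ ∀ i, (I i).card = k i := by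
  simp [clusterBoxes]

theorem card_clusterBoxes {d : ℕ} (k n : Fin d → ℕ) :
    (clusterBoxes k n).card = ∏ i, (n i).choose (k i) := by
  simp [clusterBoxes]

theorem clusterBoxes_nonempty {d : ℕ} {k n : Fin d → ℕ} (hkn : ∀ i, k i ≤ n i) :
    (clusterBoxes k n).Nonempty := by
  rw [← Finset.card_pos, card_clusterBoxes]
  exact Finset.prod_pos fun i _ => Nat.choose_pos (hkn i)

/-- The sides of a uniform random box are independent, so the average of a product over the modes
factorizes. -/
theorem sum_clusterBoxes_prod_le {d : ℕ} (k n : Fin d → ℕ) (I : ∀ i, Finset (Fin (n i)))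
    (g : Fin d → ℕ → ℝ) (hg : ∀ i h, 0 ≤ g i h) (a : Fin d → ℝ)
    (ha : ∀ i, ∑ J ∈ Finset.univ.powersetCard (k i), g i (I i ∩ J).card ≤
      (n i).choose (k i) * a i) :
    ∑ J ∈ clusterBoxes k n, ∏ i, g i (I i ∩ J i).card ≤ (clusterBoxes k n).card * ∏ i, a i := by
  rw [card_clusterBoxes, Nat.cast_prod, ← Finset.prod_mul_distrib, clusterBoxes,
    ← Finset.prod_univ_sum (fun i => Finset.univ.powersetCard (k i))
      (fun i J => g i (I i ∩ J).card)]
  exact Finset.prod_le_prod (fun i _ => Finset.sum_nonneg fun J _ => hg i _) fun i _ => ha i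

theorem sum_clusterBoxes_le {d : ℕ} {k n : Fin d → ℕ} (hkn : ∀ i, k i ≤ n i)
    {I : ∀ i, Finset (Fin (n i))} (hI : I ∈ clusterBoxes k n) {η : ℝ} (hη : 0 ≤ η)
    (hη' : η ≤ 1 / 4) (ε : ℝ) (u : (Fin d → ℕ) → ℝ)
    (hu : ∀ h : Fin d → ℕ, (∀ i, h i ≤ k i) →
      u h ≤ ε + ∑ i, largeOverlapWeight η (n i) (k i) (h i)) :
    ∑ J ∈ clusterBoxes k n, Real.exp (u fun i => (I i ∩ J i).card) ≤
      Real.exp ε * (1 + 8 * η) ^ d * (clusterBoxes k n).card := by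
  rw [mem_clusterBoxes] at hI
  calc _ ≤ ∑ J ∈ clusterBoxes k n, Real.exp ε *
        ∏ i, Real.exp (largeOverlapWeight η (n i) (k i) (I i ∩ J i).card) := by
        refine Finset.sum_le_sum fun J _ => ?_
        rw [← Real.exp_sum, ← Real.exp_add]
        refine Real.exp_le_exp.2 (hu _ fun i => ?_)
        rw [← hI i]; exact Finset.card_le_card Finset.inter_subset_left
    _ ≤ Real.exp ε * ((clusterBoxes k n).card * ∏ _i : Fin d, (1 + 8 * η)) := by
        rw [← Finset.mul_sum]
        gcongr
        exact sum_clusterBoxes_prod_le k n I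
          (fun i h => Real.exp (largeOverlapWeight η (n i) (k i) h))
          (fun _ _ => (Real.exp_pos _).le) _
          fun i => sum_exp_largeOverlapWeight_le (hkn i) (hI i) hη hη'
    _ = _ := by rw [Finset.prod_const, Finset.card_univ, Fintype.card_fin]; ring

/-- The two alternatives of `hu` are summed separately. The near-full weights vanish unless every
mode is near full, so they contribute a product over all modes, at most `(2x) ^ d`. -/
theorem sum_clusterBoxes_le_add {d : ℕ} {k n : Fin d → ℕ} (hkn : ∀ i, k i ≤ n i)
    (hk : ∀ i, 0 < k i)
    {I : ∀ i, Finset (Fin (n i))} (hI : I ∈ clusterBoxes k n) {η : ℝ} (hη : 0 ≤ η)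
    (hη' : η ≤ 1 / 4) (ε : ℝ) {γ δ : ℝ} {L : Fin d → ℝ} (hL : ∀ i, L i = Real.log (n i / k i))
    (hδL : ∀ i, 1 ≤ δ * L i) {x : ℝ} (hx : x ≤ 1 / 2)
    (hLx : ∀ i, Real.exp (-((1 - 2 * δ - γ) * L i)) ≤ x) (u : (Fin d → ℕ) → ℝ)
    (hu : ∀ h : Fin d → ℕ, (∀ i, h i ≤ k i) →
      u h ≤ ε + ∑ i, largeOverlapWeight η (n i) (k i) (h i) ∨
        ((∀ i, k i * Real.exp (-(δ * L i)) < h i) ∧ u h ≤ ∑ i, γ * (h i * L i))) :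
    ∑ J ∈ clusterBoxes k n, Real.exp (u fun i => (I i ∩ J i).card) ≤
      (Real.exp ε * (1 + 8 * η) ^ d + (2 * x) ^ d) * (clusterBoxes k n).card := by
  have hI' := mem_clusterBoxes.1 hI
  set w : (Fin d → ℕ) → ℝ := fun h => ε + ∑ i, largeOverlapWeight η (n i) (k i) (h i) with hw
  calc _ ≤ ∑ J ∈ clusterBoxes k n, (Real.exp (w fun i => (I i ∩ J i).card) +
        ∏ i, nearFullWeight γ δ (L i) (k i) (I i ∩ J i).card) := by
        refine Finset.sum_le_sum fun J _ => ?_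
        rcases hu (fun i => (I i ∩ J i).card) fun i => by
            rw [← hI' i]; exact Finset.card_le_card Finset.inter_subset_left with h1 | ⟨h1, h2⟩
        · exact (Real.exp_le_exp.2 h1).trans (le_add_of_nonneg_right
            (Finset.prod_nonneg fun i _ => nearFullWeight_nonneg _ _ _ _ _))
        · have h3 : ∏ i, nearFullWeight γ δ (L i) (k i) (I i ∩ J i).card =
              Real.exp (∑ i, γ * ((I i ∩ J i).card * L i)) := by
            rw [Real.exp_sum]
            exact Finset.prod_congr rfl fun i _ => by rw [nearFullWeight, if_pos (h1 i)]
          rw [h3]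
          exact (Real.exp_le_exp.2 h2).trans (le_add_of_nonneg_left (Real.exp_pos _).le)
    _ ≤ Real.exp ε * (1 + 8 * η) ^ d * (clusterBoxes k n).card +
          (clusterBoxes k n).card * ∏ _i : Fin d, (2 * x) := by
        rw [Finset.sum_add_distrib]
        refine add_le_add (sum_clusterBoxes_le hkn hI hη hη' ε w fun _ _ => le_rfl) ?_
        refine sum_clusterBoxes_prod_le k n I (fun i h => nearFullWeight γ δ (L i) (k i) h)
          (fun i h => nearFullWeight_nonneg _ _ _ _ _) _ fun i => ?_
        refine (sum_nearFullWeight_le (hkn i) (hk i) (hI' i) (hL i) (hδL i)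
          ((hLx i).trans hx)).trans ?_
        gcongr
        exact hLx i
    _ = _ := by rw [Finset.prod_const, Finset.card_univ, Fintype.card_fin]; ring

end Overlap

/-! ### Reduction of the minimax risk to an overlap sum. -/

section Risk

theorem outerProduct_indicatorVector {d : ℕ} {n : Fin d → ℕ} (I : ∀ i, Finset (Fin (n i)))
    (j : ∀ i, Fin (n i)) :
    outerProduct (fun i => indicatorVector (I i)) j =
      if j ∈ Fintype.piFinset I then 1 else 0 := by
  simp [outerProduct, indicatorVector, Finset.prod_ite_zero]

theorem experimentLaw_eq_withDensity {d : ℕ} {n : Fin d → ℕ} (lam : ℝ)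
    (I : ∀ i, Finset (Fin (n i))) :
    experimentLaw (lam • outerProduct fun i => indicatorVector (I i)) =
      ((noiseLaw n).prod volume).withDensity fun ω =>
        ENNReal.ofReal (shiftLikelihood lam (Fintype.piFinset I) ω.1) := by
  have h : observationLaw (lam • outerProduct fun i => indicatorVector (I i)) =
      (noiseLaw n).withDensity fun y =>
        ENNReal.ofReal (shiftLikelihood lam (Fintype.piFinset I) y) := by
    rw [observationLaw, noiseLaw, map_const_add_pi_gaussianReal]
    congr 1
    ext y
    rw [shiftLikelihood]
    congr 3
    · simp only [Pi.smul_apply, outerProduct_indicatorVector, smul_eq_mul, mul_ite, mul_one,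
        mul_zero, ite_mul, zero_mul, Finset.sum_ite_mem, Finset.univ_inter, Finset.mul_sum]
    · simp only [Pi.smul_apply, outerProduct_indicatorVector, smul_eq_mul, mul_ite, mul_one,
        mul_zero, ite_pow, ite_div, ne_eq, OfNat.ofNat_ne_zero, not_false_eq_true, zero_pow,
        zero_div, Finset.sum_ite_mem, Finset.univ_inter, Finset.sum_const, nsmul_eq_mul]
      ring
  rw [experimentLaw, h]
  exact prod_withDensity_left ((measurable_shiftLikelihood _ _).ennreal_ofReal)

instance isProbabilityMeasure_noiseLaw {d : ℕ} (n : Fin d → ℕ) :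
    IsProbabilityMeasure (noiseLaw n) := by
  unfold noiseLaw; infer_instance

theorem experimentLaw_zero {d : ℕ} (n : Fin d → ℕ) :
    experimentLaw (0 : Tensor n) = (noiseLaw n).prod volume := by
  have : (fun Z : Tensor n => 0 + Z) = id := by ext; simp
  rw [experimentLaw, observationLaw, this, Measure.map_id]

theorem chcMinimaxRisk_le_one {d : ℕ} (k n : Fin d → ℕ) (lam : ℝ) :
    chcMinimaxRisk k n lam ≤ 1 := by
  refine (iInf_le _ ⟨fun _ => true, measurable_const⟩).trans ?_
  rw [chcDetectionRisk, experimentLaw_zero]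
  simp

theorem chcMinimaxRisk_anti {d : ℕ} (k n : Fin d → ℕ) : Antitone (chcMinimaxRisk k n) := by
  intro a b hab
  refine iInf_mono fun φ => add_le_add le_rfl ?_
  refine iSup₂_mono' fun X hX => ⟨X, ?_, le_rfl⟩
  obtain ⟨I, hI, μ, hμ, rfl⟩ := hX
  exact ⟨I, hI, μ, hab.trans hμ, rfl⟩

/-- Lower bound for the detection risk in terms of the overlap of two random boxes. -/
theorem le_chcMinimaxRisk {d : ℕ} {k n : Fin d → ℕ} (hkn : ∀ i, k i ≤ n i) {lam K s t : ℝ}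
    (hlam : 0 ≤ lam) (hK : 0 ≤ K) (ht : 0 < t)
    (hscan : (2 : ℝ) ^ (∑ i, k i) * Real.exp (-K) ≤ s)
    (hsum : ∀ I ∈ clusterBoxes k n, ∑ J ∈ clusterBoxes k n,
      Real.exp (min (lam ^ 2 * ∏ i, ((I i ∩ J i).card : ℝ))
        (lam ^ 2 * (∏ i, ((I i ∩ J i).card : ℝ)) / 2 +
          lam * Real.sqrt (2 * (∏ i, ((I i ∩ J i).card : ℝ)) * K))) ≤
      (1 + s) * (clusterBoxes k n).card) :
    ENNReal.ofReal (1 - t - 3 * s / (4 * t)) ≤ chcMinimaxRisk k n lam := by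
  classical
  refine le_iInf fun φ => ?_
  -- Scanning only sub-boxes is enough, since two boxes meet in a sub-box, and it costs a union over
  -- `2 ^ ∑ k i` sets instead of the `2 ^ ∏ k i` subsets.
  set F : (∀ i, Finset (Fin (n i))) → Finset (Finset (∀ i, Fin (n i))) := fun I =>
    (Fintype.piFinset fun i => (I i).powerset).image Fintype.piFinset with hF
  have hA : MeasurableSet {y | φ.decide y = true} :=
    φ.measurable_decide (measurableSet_singleton true)
  have hAc : {y | φ.decide y = true}ᶜ = {y | φ.decide y = false} := by
    ext y; simp
  have hmp : MeasurePreserving (Prod.fst : Tensor n × unitInterval → Tensor n)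
      ((noiseLaw n).prod volume) (noiseLaw n) := measurePreserving_fst
  rw [chcDetectionRisk, experimentLaw_zero]
  have hint : ∀ g : Tensor n → ℝ, Measurable g →
      ∫ ω, g ω.1 ∂((noiseLaw n).prod (volume : Measure unitInterval)) =
        ∫ y, g y ∂(noiseLaw n) := fun g hg => by
    have h := integral_map (μ := (noiseLaw n).prod (volume : Measure unitInterval))
      measurable_fst.aemeasurable (f := g) hg.aestronglyMeasurable
    rw [hmp.map_eq] at h
    exact h.symm
  refine error_sum_ge_of_truncated_moments ((noiseLaw n).prod volume) (clusterBoxes k n)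
    (clusterBoxes_nonempty hkn)
    (fun I ω => shiftLikelihood lam (Fintype.piFinset I) ω.1)
    (fun I ω => truncatedLikelihood lam K (Fintype.piFinset I) (F I) ω.1)
    (fun I _ => (measurable_shiftLikelihood _ _).comp measurable_fst)
    (fun I _ ω => truncatedLikelihood_nonneg _ _ _ _ _)
    (fun I _ ω => truncatedLikelihood_le _ _ _ _ _)
    (fun I _ => hmp.integrable_comp_of_integrable (integrable_truncatedLikelihood _ _ _ _))
    (fun I _ J _ => hmp.integrable_comp_of_integrable
      (integrable_truncatedLikelihood_mul lam K (Fintype.piFinset I) (Fintype.piFinset J)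
        (F I) (F J)))
    ht (fun I hI => ?_) (fun I hI => ?_) hA _ fun I hI => ?_
  · rw [hint _ (measurable_truncatedLikelihood _ _ _ _)]
    refine le_trans ?_ (integral_truncatedLikelihood_ge lam hK _ _ fun D hD => ?_)
    · have hcard : ((F I).card : ℝ) ≤ 2 ^ (∑ i, k i) := by
        have h1 : (F I).card ≤ 2 ^ (∑ i, k i) := by
          refine Finset.card_image_le.trans ?_
          rw [Fintype.card_piFinset, ← Finset.prod_pow_eq_pow_sum]
          refine (Finset.prod_congr rfl fun i _ => ?_).le
          rw [Finset.card_powerset, mem_clusterBoxes.1 hI i]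
        exact_mod_cast h1
      have := mul_le_mul_of_nonneg_right hcard (Real.exp_pos (-K)).le
      linarith
    · simp only [hF, Finset.mem_image, Fintype.mem_piFinset, Finset.mem_powerset] at hD
      obtain ⟨D', hD', rfl⟩ := hD
      exact Fintype.piFinset_subset _ _ hD'
  · refine le_trans (Finset.sum_le_sum fun J hJ => ?_) (hsum I hI)
    rw [hint (fun y => truncatedLikelihood lam K (Fintype.piFinset I) (F I) y *
      truncatedLikelihood lam K (Fintype.piFinset J) (F J) y)
      ((measurable_truncatedLikelihood _ _ _ _).mul (measurable_truncatedLikelihood _ _ _ _))]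
    have h := integral_truncatedLikelihood_mul_le hlam K (Fintype.piFinset I) (Fintype.piFinset J)
      (F I) (F J) (by
        rw [← Fintype.piFinset_inter]
        refine Finset.mem_image_of_mem _ (Fintype.mem_piFinset.2 fun i => ?_)
        exact Finset.mem_powerset.2 Finset.inter_subset_left)
    rw [← Fintype.piFinset_inter, Fintype.card_piFinset, Nat.cast_prod] at h
    exact h
  · rw [hAc, ← experimentLaw_eq_withDensity]
    exact le_iSup₂ (f := fun X (_ : X ∈ chcSignals k n lam) =>
      experimentLaw X {y | φ.decide y = false}) _
      ⟨I, mem_clusterBoxes.1 hI, lam, le_rfl, rfl⟩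

end Risk

/-! ### Risk bounds at fixed dimensions. -/

section FixedSize

variable {d : ℕ} {k n : Fin d → ℕ} {lam : ℝ}

theorem largeOverlapWeight_nonneg {η : ℝ} (hη : 0 ≤ η) (N k h : ℕ) :
    0 ≤ largeOverlapWeight η N k h := by
  unfold largeOverlapWeight; split_ifs <;> positivity

theorem sq_mul_prod_le_of_small {ε η : ℝ} (hη : 0 ≤ η)
    (hε : Real.exp 2 ^ d * (lam * (∏ i, (k i : ℝ)) / Real.sqrt (∏ i, (n i : ℝ))) ^ 2 ≤ ε)
    {h : Fin d → ℕ} (hh : ∀ i, (h i : ℝ) ≤ Real.exp 2 * (k i * (k i / n i))) :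
    lam ^ 2 * ∏ i, (h i : ℝ) ≤ ε + ∑ i, largeOverlapWeight η (n i) (k i) (h i) := by
  have h1 : ∏ i, (h i : ℝ) ≤ ∏ i, (Real.exp 2 * (k i * (k i / n i : ℝ))) :=
    Finset.prod_le_prod (fun _ _ => by positivity) fun i _ => hh i
  have h2 : lam ^ 2 * ∏ i, (Real.exp 2 * (k i * (k i / n i : ℝ))) =
      Real.exp 2 ^ d * (lam * (∏ i, (k i : ℝ)) / Real.sqrt (∏ i, (n i : ℝ))) ^ 2 := by
    rw [div_pow, Real.sq_sqrt (by positivity), Finset.prod_mul_distrib, Finset.prod_mul_distrib,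
      Finset.prod_div_distrib, Finset.prod_const, Finset.card_univ, Fintype.card_fin]
    ring
  have h3 := mul_le_mul_of_nonneg_left h1 (sq_nonneg lam)
  have h4 : 0 ≤ ∑ i, largeOverlapWeight η (n i) (k i) (h i) :=
    Finset.sum_nonneg fun i _ => largeOverlapWeight_nonneg hη _ _ _
  linarith

theorem sq_mul_prod_le_of_large {ε η : ℝ} (hε : 0 ≤ ε) (hη : 0 ≤ η) {h : Fin d → ℕ} {i : Fin d}
    (hi : Real.exp 2 * (k i * (k i / n i)) ≤ (h i : ℝ))
    (hle : lam ^ 2 * ∏ j ∈ Finset.univ.erase i, (h j : ℝ) ≤ η) :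
    lam ^ 2 * ∏ i, (h i : ℝ) ≤ ε + ∑ i, largeOverlapWeight η (n i) (k i) (h i) := by
  have h1 : lam ^ 2 * ∏ i, (h i : ℝ) ≤ largeOverlapWeight η (n i) (k i) (h i) := by
    rw [← Finset.mul_prod_erase _ _ (Finset.mem_univ i), largeOverlapWeight, if_pos hi]
    have := mul_le_mul_of_nonneg_right hle (Nat.cast_nonneg (α := ℝ) (h i))
    linarith
  have h2 := Finset.single_le_sum (f := fun i => largeOverlapWeight η (n i) (k i) (h i))
    (fun i _ => largeOverlapWeight_nonneg hη (n i) (k i) (h i)) (Finset.mem_univ i)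
  linarith

/-- Lower bound for the risk when the untruncated second moment is close to `1`. -/
theorem le_chcMinimaxRisk_of_weak_signal (hkn : ∀ i, k i ≤ n i) (hlam : 0 ≤ lam) {s t ε η : ℝ}
    (hs : 0 < s) (ht : 0 < t) (hη : 0 ≤ η) (hη' : η ≤ 1 / 4)
    (hsε : Real.exp ε * (1 + 8 * η) ^ d ≤ 1 + s)
    (hε : Real.exp 2 ^ d * (lam * (∏ i, (k i : ℝ)) / Real.sqrt (∏ i, (n i : ℝ))) ^ 2 ≤ ε)
    (hle : ∀ i, lam ^ 2 * ∏ j ∈ Finset.univ.erase i, (k j : ℝ) ≤ η) :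
    ENNReal.ofReal (1 - t - 3 * s / (4 * t)) ≤ chcMinimaxRisk k n lam := by
  have hε0 : 0 ≤ ε := le_trans (by positivity) hε
  set P : ℝ := (2 : ℝ) ^ (∑ i, k i) with hP
  have hPpos : 0 < P := by positivity
  -- The scan is made vacuous: `K` is taken so large that truncation costs at most `s`, and only the
  -- untruncated half of the minimum is used.
  refine le_chcMinimaxRisk (K := max 0 (Real.log (P / s))) hkn hlam (le_max_left _ _) ht ?_
    fun I hI => ?_
  · have h1 : Real.exp (-max 0 (Real.log (P / s))) ≤ (P / s)⁻¹ := by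
      rw [← Real.exp_log (x := (P / s)⁻¹) (by positivity), Real.log_inv]
      exact Real.exp_le_exp.2 (neg_le_neg (le_max_right _ _))
    calc P * Real.exp (-max 0 (Real.log (P / s))) ≤ P * (P / s)⁻¹ := by gcongr
      _ = s := by field_simp
  · refine (sum_clusterBoxes_le hkn hI hη hη' ε (fun h => min (lam ^ 2 * ∏ i, (h i : ℝ))
      (lam ^ 2 * (∏ i, (h i : ℝ)) / 2 + lam * Real.sqrt (2 * (∏ i, (h i : ℝ)) *
        max 0 (Real.log (P / s))))) fun h hh => ?_).trans (by gcongr)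
    refine (min_le_left _ _).trans ?_
    by_cases hc : ∃ i, Real.exp 2 * (k i * (k i / n i)) ≤ (h i : ℝ)
    · obtain ⟨i, hi⟩ := hc
      refine sq_mul_prod_le_of_large hε0 hη hi (le_trans ?_ (hle i))
      gcongr with j
      exact hh j
    · push Not at hc
      exact sq_mul_prod_le_of_small hη hε fun i => (hc i).le

theorem prod_le_mul_of_ne {ρ : Fin d → ℝ} (h0 : ∀ i, 0 ≤ ρ i) (h1 : ∀ i, ρ i ≤ 1) {i j : Fin d}
    (hij : i ≠ j) : ∏ l, ρ l ≤ ρ i * ρ j := by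
  rw [← Finset.mul_prod_erase _ _ (Finset.mem_univ i),
    ← Finset.mul_prod_erase _ _ (Finset.mem_erase.2 ⟨hij.symm, Finset.mem_univ j⟩)]
  have := Finset.prod_le_one (s := (Finset.univ.erase i).erase j) (fun l _ => h0 l)
    fun l _ => h1 l
  exact mul_le_mul_of_nonneg_left (mul_le_of_le_one_right (h0 j) this) (h0 i)

/-- The truncated exponent of a near-full overlap is a proper fraction of the entropy. -/
theorem truncated_exponent_le {L : Fin d → ℝ} (hd : 2 ≤ d) (hk : ∀ i, 0 < k i)
    (hL : ∀ i, 0 ≤ L i) (hlam : 0 ≤ lam)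
    {θ B σ : ℝ} (hθ : 0 ≤ θ) (hθ1 : θ ≤ 1) (hσ : 0 ≤ σ)
    (hsig : lam ^ 2 * ∏ i, (k i : ℝ) ≤ 2 * (1 - θ) * ∑ i, k i * L i)
    (hB : ∀ i, ∑ j, k j * L j ≤ B * (k i * L i))
    {h : Fin d → ℕ} (hh : ∀ i, h i ≤ k i) :
    lam ^ 2 * (∏ i, (h i : ℝ)) / 2 +
        lam * Real.sqrt (2 * (∏ i, (h i : ℝ)) * (σ ^ 2 * ∑ i, k i * L i)) ≤
      ∑ i, (1 - θ + 2 * B * σ) * (h i * L i) := by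
  set ρ : Fin d → ℝ := fun i => h i / k i with hρ
  set A : ℝ := ∑ i, k i * L i with hA
  have hkR : ∀ i, (0 : ℝ) < k i := fun i => by exact_mod_cast hk i
  have hA0 : 0 ≤ A := Finset.sum_nonneg fun i _ => mul_nonneg (hkR i).le (hL i)
  have hρ0 : ∀ i, 0 ≤ ρ i := fun i => by positivity
  have hρ1 : ∀ i, ρ i ≤ 1 := fun i => (div_le_one (hkR i)).2 (by exact_mod_cast hh i)
  have hρk : ∀ i, (h i : ℝ) = ρ i * k i := fun i => (div_mul_cancel₀ _ (hkR i).ne').symm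
  set R : ℝ := ∏ i, ρ i with hR
  have hR0 : 0 ≤ R := Finset.prod_nonneg fun i _ => hρ0 i
  have hRρ : ∀ i, R ≤ ρ i := fun i => by
    rw [hR, ← Finset.mul_prod_erase _ _ (Finset.mem_univ i)]
    exact mul_le_of_le_one_right (hρ0 i) (Finset.prod_le_one (fun l _ => hρ0 l) fun l _ => hρ1 l)
  have hu : lam ^ 2 * ∏ i, (h i : ℝ) ≤ 2 * (1 - θ) * A * R := by
    simp_rw [hρk]
    rw [Finset.prod_mul_distrib, mul_left_comm, mul_comm]
    exact mul_le_mul_of_nonneg_right hsig hR0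
  set W : ℝ := ∑ i, h i * L i with hW
  have hAR : A * R ≤ W := by
    rw [hA, hW, Finset.sum_mul]
    refine Finset.sum_le_sum fun i _ => ?_
    rw [hρk, mul_comm, ← mul_assoc]
    have := hL i
    have := hRρ i
    have := hkR i
    gcongr
  -- Two distinct modes are needed here: `R ≤ ρ i * ρ j` gives `√R ≤ (ρ i + ρ j) / 2`, which is
  -- linear in the overlap fractions, and entropy balance turns each `A * ρ i` into at most `B * (h
  -- i * L i)`.
  have hAsqrt : A * Real.sqrt R ≤ B * W := by
    have hij : (⟨0, by omega⟩ : Fin d) ≠ ⟨1, by omega⟩ := by simp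
    generalize (⟨0, by omega⟩ : Fin d) = i at hij
    generalize (⟨1, by omega⟩ : Fin d) = j at hij
    have hs : Real.sqrt R ≤ (ρ i + ρ j) / 2 := by
      refine Real.sqrt_le_iff.2 ⟨by linarith [hρ0 i, hρ0 j], ?_⟩
      have := prod_le_mul_of_ne hρ0 hρ1 hij
      nlinarith [sq_nonneg (ρ i - ρ j)]
    have hterm : ∀ i, A * ρ i ≤ B * (h i * L i) := fun i => by
      have := mul_le_mul_of_nonneg_right (hB i) (hρ0 i)
      rw [hρk i]; linarith
    have hB0 : ∀ i, 0 ≤ B * (h i * L i) := fun i =>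
      (mul_nonneg hA0 (hρ0 i)).trans (hterm i)
    have hle : ∀ i, B * (h i * L i) ≤ B * W := fun i => by
      rw [hW, Finset.mul_sum]
      exact Finset.single_le_sum (f := fun i => B * (h i * L i)) (fun i _ => hB0 i)
        (Finset.mem_univ i)
    have := mul_le_mul_of_nonneg_left hs hA0
    linarith [hterm i, hterm j, hle i, hle j]
  have hsq : lam * Real.sqrt (2 * (∏ i, (h i : ℝ)) * (σ ^ 2 * A)) ≤ 2 * σ * (A * Real.sqrt R) := by
    have h1 : lam * Real.sqrt (2 * (∏ i, (h i : ℝ)) * (σ ^ 2 * A)) =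
        Real.sqrt (2 * σ ^ 2 * A * (lam ^ 2 * ∏ i, (h i : ℝ))) := by
      rw [show 2 * σ ^ 2 * A * (lam ^ 2 * ∏ i, (h i : ℝ)) =
        lam ^ 2 * (2 * (∏ i, (h i : ℝ)) * (σ ^ 2 * A)) by ring,
        Real.sqrt_mul (sq_nonneg lam), Real.sqrt_sq hlam]
    have h2 : 2 * σ * (A * Real.sqrt R) = Real.sqrt ((2 * σ * A) ^ 2 * R) := by
      rw [Real.sqrt_mul (sq_nonneg _), Real.sqrt_sq (by positivity)]; ring
    rw [h1, h2]
    refine Real.sqrt_le_sqrt ?_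
    calc 2 * σ ^ 2 * A * (lam ^ 2 * ∏ i, (h i : ℝ)) ≤ 2 * σ ^ 2 * A * (2 * (1 - θ) * A * R) := by
          gcongr
      _ = (2 * σ * A) ^ 2 * R * (1 - θ) := by ring
      _ ≤ _ := mul_le_of_le_one_right (by positivity) (by linarith)
  rw [← Finset.mul_sum]
  have e1 := mul_le_mul_of_nonneg_left hAR (sub_nonneg.2 hθ1)
  have e2 := mul_le_mul_of_nonneg_left hAsqrt hσ
  linarith

/-- Either all overlaps are near their means, or a large mode `i` coexists with another mode `j` at
most `k j * e ^ (-δ L j)`, or all modes are near full. In the mixed case `lam ^ 2 * ∏ l ≠ i, k l ≤ 2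
B L i`, and the deficit of mode `j` brings this down to `η`. Only the last case needs the
truncation. -/
theorem exponent_dichotomy {L : Fin d → ℝ} (hd : 2 ≤ d) (hkn : ∀ i, k i ≤ n i)
    (hk : ∀ i, 0 < k i) (hL : ∀ i, L i = Real.log (n i / k i)) (hlam : 0 ≤ lam)
    {θ B σ δ ε η : ℝ} (hθ : 0 ≤ θ) (hθ1 : θ ≤ 1) (hσ : 0 ≤ σ) (hη : 0 ≤ η)
    (hsig : lam ^ 2 * ∏ i, (k i : ℝ) ≤ 2 * (1 - θ) * ∑ i, k i * L i)
    (hB : ∀ i, ∑ j, k j * L j ≤ B * (k i * L i))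
    (hδL : ∀ i, 2 ≤ (1 - δ) * L i)
    (hε : Real.exp 2 ^ d * (lam * (∏ i, (k i : ℝ)) / Real.sqrt (∏ i, (n i : ℝ))) ^ 2 ≤ ε)
    (hLL : ∀ i j, i ≠ j → 2 * B * (L i * Real.exp (-(δ * L j))) ≤ η)
    {h : Fin d → ℕ} (hh : ∀ i, h i ≤ k i) :
    min (lam ^ 2 * ∏ i, (h i : ℝ)) (lam ^ 2 * (∏ i, (h i : ℝ)) / 2 +
        lam * Real.sqrt (2 * (∏ i, (h i : ℝ)) * (σ ^ 2 * ∑ i, k i * L i))) ≤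
        ε + ∑ i, largeOverlapWeight η (n i) (k i) (h i) ∨
      ((∀ i, k i * Real.exp (-(δ * L i)) < h i) ∧
        min (lam ^ 2 * ∏ i, (h i : ℝ)) (lam ^ 2 * (∏ i, (h i : ℝ)) / 2 +
          lam * Real.sqrt (2 * (∏ i, (h i : ℝ)) * (σ ^ 2 * ∑ i, k i * L i))) ≤
        ∑ i, (1 - θ + 2 * B * σ) * (h i * L i)) := by
  have hε0 : 0 ≤ ε := le_trans (by positivity) hε
  have hkR : ∀ i, (0 : ℝ) < k i := fun i => by exact_mod_cast hk i
  have hL0 : ∀ i, 0 ≤ L i := fun i => by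
    rw [hL]
    exact Real.log_nonneg ((one_le_div (hkR i)).2 (by exact_mod_cast hkn i))
  have hkn' : ∀ i, (k i / n i : ℝ) = Real.exp (-L i) := fun i => by
    have : (0 : ℝ) < n i := (hkR i).trans_le (by exact_mod_cast hkn i)
    have := hkR i
    rw [hL, Real.exp_neg, Real.exp_log (by positivity), inv_div]
  by_cases hsmall : ∀ i, (h i : ℝ) ≤ Real.exp 2 * (k i * (k i / n i))
  · exact Or.inl ((min_le_left _ _).trans (sq_mul_prod_le_of_small hη hε hsmall))
  by_cases hmixed : ∃ i j, i ≠ j ∧ Real.exp 2 * (k i * (k i / n i)) ≤ (h i : ℝ) ∧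
      (h j : ℝ) ≤ k j * Real.exp (-(δ * L j))
  · obtain ⟨i, j, hij, hi, hj⟩ := hmixed
    refine Or.inl ((min_le_left _ _).trans (sq_mul_prod_le_of_large hε0 hη hi
      (le_trans ?_ (hLL i j hij))))
    have hji : j ∈ Finset.univ.erase i := Finset.mem_erase.2 ⟨hij.symm, Finset.mem_univ j⟩
    have h1 : ∏ l ∈ Finset.univ.erase i, (h l : ℝ) ≤
        (∏ l ∈ Finset.univ.erase i, (k l : ℝ)) * Real.exp (-(δ * L j)) := by
      rw [← Finset.mul_prod_erase _ _ hji, ← Finset.mul_prod_erase _ _ hji, mul_right_comm]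
      gcongr with l
      exact hh l
    have h2 : lam ^ 2 * ∏ l ∈ Finset.univ.erase i, (k l : ℝ) ≤ 2 * B * L i := by
      refine le_of_mul_le_mul_left ?_ (hkR i)
      calc k i * (lam ^ 2 * ∏ l ∈ Finset.univ.erase i, (k l : ℝ)) = lam ^ 2 * ∏ l, (k l : ℝ) := by
            rw [← Finset.mul_prod_erase _ _ (Finset.mem_univ i)]; ring
        _ ≤ 2 * (1 - θ) * ∑ i, k i * L i := hsig
        _ ≤ 2 * 1 * ∑ i, k i * L i := by
            have : 0 ≤ ∑ i, k i * L i :=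
              Finset.sum_nonneg fun i _ => mul_nonneg (hkR i).le (hL0 i)
            gcongr
            linarith
        _ ≤ 2 * 1 * (B * (k i * L i)) := by have := hB i; gcongr
        _ = _ := by ring
    calc _ ≤ lam ^ 2 * ((∏ l ∈ Finset.univ.erase i, (k l : ℝ)) * Real.exp (-(δ * L j))) := by
          gcongr
      _ = (lam ^ 2 * ∏ l ∈ Finset.univ.erase i, (k l : ℝ)) * Real.exp (-(δ * L j)) := by ring
      _ ≤ 2 * B * L i * Real.exp (-(δ * L j)) := by gcongr
      _ = _ := by ring
  · refine Or.inr ⟨?_, (min_le_right _ _).trans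
      (truncated_exponent_le hd hk hL0 hlam hθ hθ1 hσ hsig hB hh)⟩
    push Not at hsmall hmixed
    -- Near full implies large. Hence one large mode forces all others to be near full, and any of
    -- those then forces the first one to be near full too.
    have hthr : ∀ j, Real.exp 2 * (k j * (k j / n j)) ≤ k j * Real.exp (-(δ * L j)) := fun j => by
      rw [hkn', mul_left_comm, ← Real.exp_add]
      have := hδL j
      gcongr
      linarith
    obtain ⟨i, hi⟩ := hsmall
    have hne : ∀ j, i ≠ j → k j * Real.exp (-(δ * L j)) < h j := fun j hij =>
      hmixed i j hij hi.le
    have : Nontrivial (Fin d) := Fin.nontrivial_iff_two_le.2 hd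
    obtain ⟨j, hj⟩ := exists_ne i
    intro l
    by_cases hl : i = l
    · subst hl
      exact hmixed j i hj ((hthr j).trans (hne j hj.symm).le)
    · exact hne l hl

/-- Lower bound for the risk when the truncated second moment is close to `1`. -/
theorem le_chcMinimaxRisk_of_sparse {L : Fin d → ℝ} (hd : 2 ≤ d) (hkn : ∀ i, k i ≤ n i)
    (hk : ∀ i, 0 < k i) (hL : ∀ i, L i = Real.log (n i / k i)) (hlam : 0 ≤ lam)
    {θ B σ δ ε η s t x : ℝ} (hθ : 0 ≤ θ) (hθ1 : θ ≤ 1) (hσ : 0 ≤ σ) (hη : 0 ≤ η)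
    (hη' : η ≤ 1 / 4) (hs : 0 < s) (ht : 0 < t) (hx : x ≤ 1 / 2)
    (hsε : Real.exp ε * (1 + 8 * η) ^ d + (2 * x) ^ d ≤ 1 + s)
    (hsig : lam ^ 2 * ∏ i, (k i : ℝ) ≤ 2 * (1 - θ) * ∑ i, k i * L i)
    (hB : ∀ i, ∑ j, k j * L j ≤ B * (k i * L i))
    (hδL : ∀ i, 2 ≤ (1 - δ) * L i) (hδL' : ∀ i, 1 ≤ δ * L i)
    (hε : Real.exp 2 ^ d * (lam * (∏ i, (k i : ℝ)) / Real.sqrt (∏ i, (n i : ℝ))) ^ 2 ≤ ε)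
    (hLL : ∀ i j, i ≠ j → 2 * B * (L i * Real.exp (-(δ * L j))) ≤ η)
    (hLx : ∀ i, Real.exp (-((1 - 2 * δ - (1 - θ + 2 * B * σ)) * L i)) ≤ x)
    (hσL : ∀ i, 1 + |Real.log s| ≤ σ ^ 2 * L i) :
    ENNReal.ofReal (1 - t - 3 * s / (4 * t)) ≤ chcMinimaxRisk k n lam := by
  have hkR : ∀ i, (1 : ℝ) ≤ k i := fun i => by exact_mod_cast hk i
  have hK : (∑ i, (k i : ℝ)) * (1 + |Real.log s|) ≤ σ ^ 2 * ∑ i, k i * L i := by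
    rw [Finset.sum_mul, Finset.mul_sum]
    refine Finset.sum_le_sum fun i _ => ?_
    rw [mul_left_comm]
    exact mul_le_mul_of_nonneg_left (hσL i) (Nat.cast_nonneg _)
  have hk1 : (1 : ℝ) ≤ ∑ i, (k i : ℝ) :=
    (hkR ⟨0, by omega⟩).trans (Finset.single_le_sum (f := fun i => (k i : ℝ))
      (fun i _ => Nat.cast_nonneg _) (Finset.mem_univ _))
  have hK' : ∑ i, (k i : ℝ) + |Real.log s| ≤ σ ^ 2 * ∑ i, k i * L i := by
    nlinarith [abs_nonneg (Real.log s)]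
  refine le_chcMinimaxRisk (K := σ ^ 2 * ∑ i, k i * L i) hkn hlam
    (le_trans (by positivity) hK') ht ?_ fun I hI => ?_
  · have h2 : (2 : ℝ) ^ (∑ i, k i) ≤ Real.exp (∑ i, (k i : ℝ)) := by
      rw [← Nat.cast_sum, ← mul_one ((∑ i, k i : ℕ) : ℝ), Real.exp_nat_mul]
      have := Real.add_one_le_exp (1 : ℝ)
      gcongr
      linarith
    calc _ ≤ Real.exp (∑ i, (k i : ℝ)) * Real.exp (-(σ ^ 2 * ∑ i, k i * L i)) := by gcongr
      _ = Real.exp (∑ i, (k i : ℝ) - σ ^ 2 * ∑ i, k i * L i) := by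
          rw [← Real.exp_add, sub_eq_add_neg]
      _ ≤ Real.exp (Real.log s) := Real.exp_le_exp.2 (by linarith [neg_abs_le (Real.log s)])
      _ = s := Real.exp_log hs
  · exact (sum_clusterBoxes_le_add hkn hk hI hη hη' ε hL hδL' hx hLx
      (fun h => min (lam ^ 2 * ∏ i, (h i : ℝ)) (lam ^ 2 * (∏ i, (h i : ℝ)) / 2 +
        lam * Real.sqrt (2 * (∏ i, (h i : ℝ)) * (σ ^ 2 * ∑ i, k i * L i))))
      fun h hh => exponent_dichotomy hd hkn hk hL hlam hθ hθ1 hσ hη hsig hB hδL hε hLL hh).trans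
        (by gcongr)

end FixedSize

/-! ### Choice of parameters and passage to the limit. -/

section Asymptotics

variable {d : ℕ} {k n : ℕ → Fin d → ℕ} {lam : ℕ → ℝ}

/-- The constant test gives risk at most `1`. Raising `lam` to `max (lam m) 0` shrinks the signal
class, so a lower bound for the nonnegative strength transfers back. -/
theorem tendsto_chcMinimaxRisk_one_of_eventually_ge
    (h : ∀ s t : ℝ, 0 < s → 0 < t → ∀ᶠ m in atTop,
      ENNReal.ofReal (1 - t - 3 * s / (4 * t)) ≤ chcMinimaxRisk (k m) (n m) (max (lam m) 0)) :
    Tendsto (fun m => chcMinimaxRisk (k m) (n m) (lam m)) atTop (𝓝 1) := by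
  refine tendsto_order.2 ⟨fun a ha => ?_, fun a ha =>
    Eventually.of_forall fun m => (chcMinimaxRisk_le_one _ _ _).trans_lt ha⟩
  have ha' : a.toReal < 1 := by
    have := (ENNReal.toReal_lt_toReal ha.ne_top ENNReal.one_ne_top).2 ha
    simpa using this
  set e := (1 - a.toReal) / 2 with he
  have hepos : 0 < e := by rw [he]; linarith
  -- With this `s` and `t` the losses `t` and `3 * s / (4 * t)` are both `e / 2`.
  filter_upwards [h (e ^ 2 / 3) (e / 2) (by positivity) (by positivity)] with m hm
  refine lt_of_lt_of_le ?_ (hm.trans (chcMinimaxRisk_anti _ _ (le_max_left _ _)))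
  have h1 : 1 - e / 2 - 3 * (e ^ 2 / 3) / (4 * (e / 2)) = 1 - e := by field_simp; ring
  rw [h1, ENNReal.lt_ofReal_iff_toReal_lt ha.ne_top]
  linarith

theorem exists_small_parameters (d : ℕ) {s : ℝ} (hs : 0 < s) :
    ∃ η : ℝ, 0 < η ∧ η ≤ 1 / 4 ∧ Real.exp η * (1 + 8 * η) ^ d ≤ 1 + s := by
  have hc : Tendsto (fun η : ℝ => Real.exp η * (1 + 8 * η) ^ d) (𝓝[>] 0) (𝓝 1) := by
    have : Continuous fun η : ℝ => Real.exp η * (1 + 8 * η) ^ d := by fun_prop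
    simpa using (this.tendsto 0).mono_left nhdsWithin_le_nhds
  have h1 := hc.eventually_le_const (show (1 : ℝ) < 1 + s by linarith)
  have h2 : ∀ᶠ η : ℝ in 𝓝[>] 0, η ≤ 1 / 4 :=
    (eventually_le_nhds (by norm_num)).filter_mono nhdsWithin_le_nhds
  obtain ⟨η, ⟨ha, hb⟩, hpos⟩ := ((h1.and h2).and self_mem_nhdsWithin).exists
  exact ⟨η, hpos, hb, ha⟩

theorem eventually_mean_le {b : ℕ → ℝ} (hb : Tendsto b atTop (𝓝 0)) (C : ℝ) {ε : ℝ}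
    (hε : 0 < ε) : ∀ᶠ m in atTop, C * b m ^ 2 ≤ ε := by
  have h : Tendsto (fun m => C * b m ^ 2) atTop (𝓝 0) := by
    simpa using (hb.pow 2).const_mul C
  exact h.eventually_le_const hε

theorem tendsto_log_div_atTop_of_sparse (hreg : GrowingSparseRegime k n) (i : Fin d) :
    Tendsto (fun m => Real.log ((n m i : ℝ) / k m i)) atTop atTop := by
  refine Real.tendsto_log_atTop.comp ?_
  have hpos : ∀ᶠ m in atTop, (k m i : ℝ) / n m i ∈ Set.Ioi (0 : ℝ) := by
    filter_upwards [(hreg.cluster_tendsto i).eventually_gt_atTop 0,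
      (hreg.size_tendsto i).eventually_gt_atTop 0] with m h1 h2
    exact div_pos (G₀ := ℝ) (Nat.cast_pos.2 h1) (Nat.cast_pos.2 h2)
  have := tendsto_inv_nhdsGT_zero.comp
    (tendsto_nhdsWithin_iff.2 ⟨hreg.sparsity_tendsto i, hpos⟩)
  simpa [Function.comp_def] using this

/-- Eventually `log a ≤ (δ / 2) b`, so half of the exponential decay absorbs `a`. This is how the
iterated-logarithm condition controls the mixed overlaps. -/
theorem tendsto_mul_exp_neg_of_loglog {a b : ℕ → ℝ} (ha : Tendsto a atTop atTop)
    (hb : Tendsto b atTop atTop) (hab : Tendsto (fun m => Real.log (a m) / b m) atTop (𝓝 0))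
    {δ : ℝ} (hδ : 0 < δ) : Tendsto (fun m => a m * Real.exp (-(δ * b m))) atTop (𝓝 0) := by
  have hlim : Tendsto (fun m => Real.exp (-(δ / 2 * b m))) atTop (𝓝 0) :=
    Real.tendsto_exp_neg_atTop_nhds_zero.comp (hb.const_mul_atTop (by positivity))
  refine squeeze_zero' ?_ ?_ hlim
  · filter_upwards [ha.eventually_ge_atTop 0] with m hm
    positivity
  · filter_upwards [ha.eventually_gt_atTop 0, hb.eventually_gt_atTop 0,
      hab.eventually_le_const (show (0 : ℝ) < δ / 2 by positivity)] with m h1 h2 h3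
    rw [div_le_iff₀ h2] at h3
    calc a m * Real.exp (-(δ * b m)) = Real.exp (Real.log (a m) + -(δ * b m)) := by
          rw [Real.exp_add, Real.exp_log h1]
      _ ≤ _ := Real.exp_le_exp.2 (by linarith)

theorem exists_entropy_balance (hreg : GrowingSparseRegime k n) (hbal : BalancedModes k n) :
    ∃ B : ℝ, 0 < B ∧ ∀ᶠ m in atTop, ∀ i,
      ∑ j, (k m j : ℝ) * Real.log ((n m j : ℝ) / k m j) ≤
        B * (k m i * Real.log ((n m i : ℝ) / k m i)) := by
  have hO : ∀ i, (fun m => ∑ j, (k m j : ℝ) * Real.log ((n m j : ℝ) / k m j)) =O[atTop]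
      fun m => (k m i : ℝ) * Real.log ((n m i : ℝ) / k m i) := fun i => by
    refine IsBigO.fun_sum fun j _ => ?_
    rcases eq_or_ne j i with rfl | hji
    · exact isBigO_refl _ _
    · exact (hbal.asymp j i hji).1
  have hC : ∀ i, ∃ C : ℝ, 0 < C ∧ ∀ᶠ m in atTop,
      ∑ j, (k m j : ℝ) * Real.log ((n m j : ℝ) / k m j) ≤
        C * (k m i * Real.log ((n m i : ℝ) / k m i)) := fun i => by
    obtain ⟨C, hC, hb⟩ := (hO i).exists_pos
    refine ⟨C, hC, ?_⟩
    filter_upwards [hb.bound, (tendsto_log_div_atTop_of_sparse hreg i).eventually_ge_atTop 0]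
      with m h1 h2
    rw [Real.norm_of_nonneg (mul_nonneg (Nat.cast_nonneg _) h2)] at h1
    exact (Real.le_norm_self _).trans h1
  choose C hC hb using hC
  refine ⟨1 + ∑ i, C i, add_pos_of_pos_of_nonneg one_pos
    (Finset.sum_nonneg fun i _ => (hC i).le), ?_⟩
  filter_upwards [eventually_all.2 hb, eventually_all.2 fun i =>
    (tendsto_log_div_atTop_of_sparse hreg i).eventually_ge_atTop 0] with m h1 h2 i
  refine (h1 i).trans (mul_le_mul_of_nonneg_right ?_ (mul_nonneg (Nat.cast_nonneg _) (h2 i)))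
  have := Finset.single_le_sum (f := C) (fun i _ => (hC i).le) (Finset.mem_univ i)
  linarith

theorem exists_signal_gap (hd : 0 < d) (hreg : GrowingSparseRegime k n)
    (hlim : limsup (fun m => ((lam m * Real.sqrt (∏ i, (k m i : ℝ)) /
      Real.sqrt (2 * ∑ i, (k m i : ℝ) * Real.log ((n m i : ℝ) / k m i)) : ℝ) : EReal)) atTop < 1) :
    ∃ θ : ℝ, 0 < θ ∧ θ ≤ 1 ∧ ∀ᶠ m in atTop, max (lam m) 0 ^ 2 * ∏ i, (k m i : ℝ) ≤
      2 * (1 - θ) * ∑ i, (k m i : ℝ) * Real.log ((n m i : ℝ) / k m i) := by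
  obtain ⟨c, hc1, hc2⟩ := EReal.lt_iff_exists_real_btwn.1 hlim
  have hc : c < 1 := by exact_mod_cast hc2
  set c' := max c 0 with hc'
  have hc'0 : 0 ≤ c' := le_max_right _ _
  have hc'1 : c' < 1 := max_lt hc one_pos
  -- The gap appears after squaring a bound with constant `c' < 1`; clipping `c` at `0` keeps the
  -- squaring valid when `lam m` is negative.
  refine ⟨1 - c' ^ 2, by nlinarith, by nlinarith, ?_⟩
  filter_upwards [eventually_lt_of_limsup_lt hc1, eventually_all.2 fun i =>
    (tendsto_log_div_atTop_of_sparse hreg i).eventually_gt_atTop 0, eventually_all.2 fun i =>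
    (hreg.cluster_tendsto i).eventually_gt_atTop 0] with m h1 h2 h3
  set A := ∑ i, (k m i : ℝ) * Real.log ((n m i : ℝ) / k m i) with hA
  have hApos : 0 < A := Finset.sum_pos
    (fun i _ => mul_pos (by exact_mod_cast h3 i) (h2 i)) ⟨⟨0, hd⟩, Finset.mem_univ _⟩
  have h4 : lam m * Real.sqrt (∏ i, (k m i : ℝ)) ≤ c * Real.sqrt (2 * A) := by
    rw [← div_le_iff₀ (by positivity)]
    exact_mod_cast h1.le
  have h5 : max (lam m) 0 * Real.sqrt (∏ i, (k m i : ℝ)) ≤ c' * Real.sqrt (2 * A) := by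
    rcases le_total (lam m) 0 with h | h
    · rw [max_eq_right h, zero_mul]; positivity
    · rw [max_eq_left h]
      exact h4.trans (mul_le_mul_of_nonneg_right (le_max_left _ _) (Real.sqrt_nonneg _))
  have h6 := pow_le_pow_left₀ (by positivity) h5 2
  rw [mul_pow, mul_pow, Real.sq_sqrt (by positivity), Real.sq_sqrt (by positivity)] at h6
  linarith

theorem tendsto_max_zero_mul_div {p q : ℕ → ℝ} (hp : ∀ m, 0 ≤ p m)
    (hq : ∀ m, 0 ≤ q m) (h : Tendsto (fun m => lam m * p m / q m) atTop (𝓝 0)) :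
    Tendsto (fun m => max (lam m) 0 * p m / q m) atTop (𝓝 0) := by
  have h1 : Tendsto (fun m => max (lam m * p m / q m) 0) atTop (𝓝 0) := by
    simpa using h.max (tendsto_const_nhds (x := (0 : ℝ)))
  refine h1.congr fun m => ?_
  rw [mul_div_assoc, mul_div_assoc, max_mul_of_nonneg _ _ (div_nonneg (hp m) (hq m)), zero_mul]

theorem tendsto_chcMinimaxRisk_of_growingSparse (hd : 2 ≤ d) (hkn : ∀ m i, k m i ≤ n m i)
    (hreg : GrowingSparseRegime k n) (hbal : BalancedModes k n)
    (hmean : Tendsto (fun m => lam m * (∏ i, (k m i : ℝ)) / Real.sqrt (∏ i, (n m i : ℝ)))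
      atTop (𝓝 0))
    (hlim : limsup (fun m => ((lam m * Real.sqrt (∏ i, (k m i : ℝ)) /
      Real.sqrt (2 * ∑ i, (k m i : ℝ) * Real.log ((n m i : ℝ) / k m i)) : ℝ) : EReal)) atTop < 1) :
    Tendsto (fun m => chcMinimaxRisk (k m) (n m) (lam m)) atTop (𝓝 1) := by
  refine tendsto_chcMinimaxRisk_one_of_eventually_ge fun s t hs ht => ?_
  obtain ⟨B, hB0, hB⟩ := exists_entropy_balance hreg hbal
  obtain ⟨θ, hθ0, hθ1, hθ⟩ := exists_signal_gap (by omega) hreg hlim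
  obtain ⟨η, hη0, hη, hηs⟩ := exists_small_parameters d (half_pos hs)
  have hL := fun i => tendsto_log_div_atTop_of_sparse hreg i
  -- The gap `θ` is shared out: the scan slack costs `2Bσ = θ / 2` and the near-full tolerance costs
  -- `2δ = θ / 4`, leaving a margin of `θ / 4` in the entropy comparison.
  set σ := θ / (4 * B) with hσ
  have hσ0 : 0 < σ := by positivity
  have hBσ : 2 * B * σ = θ / 2 := by rw [hσ]; field_simp; norm_num
  set δ := θ / 8 with hδ
  have hδ0 : 0 < δ := by positivity
  -- Half of the budget `s` went to `η`; this `x` keeps the near-full term `(2x) ^ d` within the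
  -- other half.
  set x := min (1 / 2) (s / 4) with hx
  have hx0 : 0 < x := lt_min (by norm_num) (by positivity)
  have hxs : (2 * x) ^ d ≤ s / 2 := by
    calc (2 * x) ^ d ≤ 2 * x := pow_le_of_le_one (by positivity)
          (by linarith [min_le_left (1 / 2) (s / 4)]) (by omega)
      _ ≤ s / 2 := by linarith [min_le_right (1 / 2) (s / 4)]
  have hc : 0 < 1 - 2 * δ - (1 - θ + 2 * B * σ) := by rw [hBσ, hδ]; linarith
  filter_upwards [hB, hθ,
    eventually_all.2 fun i => (hreg.cluster_tendsto i).eventually_gt_atTop 0,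
    eventually_all.2 fun i => ((hL i).const_mul_atTop
      (show 0 < 1 - δ by rw [hδ]; linarith)).eventually_ge_atTop 2,
    eventually_all.2 fun i => ((hL i).const_mul_atTop hδ0).eventually_ge_atTop 1,
    eventually_mean_le (tendsto_max_zero_mul_div
      (fun m => Finset.prod_nonneg fun i _ => Nat.cast_nonneg _) (fun m => Real.sqrt_nonneg _)
      hmean) (Real.exp 2 ^ d) hη0,
    (eventually_all.2 fun i => eventually_all.2 fun j => eventually_imp_distrib_left.2 fun hij =>
      (tendsto_mul_exp_neg_of_loglog (hL i) (hL j) (hbal.loglog_div_tendsto i j hij)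
        hδ0).eventually_le_const (show 0 < η / (2 * B) by positivity)),
    eventually_all.2 fun i => (Real.tendsto_exp_neg_atTop_nhds_zero.comp
      ((hL i).const_mul_atTop hc)).eventually_le_const hx0,
    eventually_all.2 fun i => ((hL i).const_mul_atTop
      (show 0 < σ ^ 2 by positivity)).eventually_ge_atTop (1 + |Real.log s|)]
    with m h1 h2 h3 h4 h5 h6 h7 h8 h9
  exact le_chcMinimaxRisk_of_sparse hd (hkn m) h3 (fun i => rfl) (le_max_right _ _) hθ0.le hθ1
    hσ0.le hη0.le hη hs ht (min_le_left _ _) (by linarith) h2 h1 h4 h5 h6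
    (fun i j hij => by
      have := h7 i j hij
      rwa [le_div_iff₀' (by positivity)] at this) h8 h9

theorem tendsto_zero_of_tendsto_log_div {N : ℕ → ℕ} (hN : Tendsto N atTop atTop) {a : ℕ → ℝ}
    (ha : ∀ᶠ m in atTop, 0 < a m) {l : ℝ} (hl : l < 0)
    (h : Tendsto (fun m => Real.log (a m) / Real.log (N m)) atTop (𝓝 l)) :
    Tendsto a atTop (𝓝 0) := by
  have hlogN : Tendsto (fun m => Real.log (N m)) atTop atTop :=
    Real.tendsto_log_atTop.comp (tendsto_natCast_atTop_atTop.comp hN)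
  refine (Real.tendsto_exp_atBot.comp (h.neg_mul_atTop hl hlogN)).congr' ?_
  filter_upwards [ha, hlogN.eventually_gt_atTop 0] with m h1 h2
  rw [Function.comp_apply, div_mul_cancel₀ _ h2.ne', Real.exp_log h1]

theorem TildeTheta.tendsto_log_div {N : ℕ → ℕ} (hN : Tendsto N atTop atTop) {a : ℕ → ℝ} {γ : ℝ}
    (h : TildeTheta N a fun m => (N m : ℝ) ^ γ) :
    Tendsto (fun m => Real.log (a m) / Real.log (N m)) atTop (𝓝 γ) := by
  obtain ⟨-, l, h1, h2⟩ := h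
  have hlogN : Tendsto (fun m => Real.log (N m)) atTop atTop :=
    Real.tendsto_log_atTop.comp (tendsto_natCast_atTop_atTop.comp hN)
  have h3 : Tendsto (fun m => Real.log ((N m : ℝ) ^ γ) / Real.log (N m)) atTop (𝓝 γ) := by
    refine tendsto_const_nhds.congr' ?_
    filter_upwards [hN.eventually_gt_atTop 0, hlogN.eventually_gt_atTop 0] with m h4 h5
    rw [Real.log_rpow (by exact_mod_cast h4), mul_div_assoc, div_self h5.ne', mul_one]
  rwa [tendsto_nhds_unique h3 h2]

/-- Each term in the maximum is one decay condition: `lam ∏ k / √∏ n` has exponent `-β + dα - d/2`,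
and `lam ^ 2 * k ^ (d - 1)` has exponent `-2β + (d - 1)α`. Both are negative, so the weak-signal
bound applies without truncation. -/
theorem tendsto_chcMinimaxRisk_of_polynomial (hd : 2 ≤ d) (hkn : ∀ m i, k m i ≤ n m i)
    {α β : ℝ} (hreg : PolynomialRegime k n lam α β) (hβ : chcDetectionThreshold d α < β) :
    Tendsto (fun m => chcMinimaxRisk (k m) (n m) (lam m)) atTop (𝓝 1) := by
  refine tendsto_chcMinimaxRisk_one_of_eventually_ge fun s t hs ht => ?_
  obtain ⟨η, hη0, hη, hηs⟩ := exists_small_parameters d hs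
  set o : Fin d := ⟨0, by omega⟩ with ho
  have hβ1 : (d : ℝ) * α - d / 2 < β := (le_max_left _ _).trans_lt hβ
  have hβ2 : ((d : ℝ) - 1) * α / 2 < β := (le_max_right _ _).trans_lt hβ
  have hN := hreg.max_tendsto
  have hk := (hreg.cluster_order o).tendsto_log_div hN
  have hlam := hreg.signal_order.tendsto_log_div hN
  have hkpos : ∀ᶠ m in atTop, (0 : ℝ) < k m o := (hreg.cluster_order o).1.mono fun m h => h.1
  have hlampos : ∀ᶠ m in atTop, 0 < lam m := hreg.signal_order.1.mono fun m h => h.1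
  have hnN : ∀ m i, n m i = maxSize n m := fun m i => by
    refine le_antisymm (Finset.le_sup (f := n m) (Finset.mem_univ i)) (Finset.sup_le fun j _ => ?_)
    exact (hreg.size_eq m j i).le
  have hlogN : Tendsto (fun m => Real.log (maxSize n m)) atTop atTop :=
    Real.tendsto_log_atTop.comp (tendsto_natCast_atTop_atTop.comp hN)
  have hmean : Tendsto (fun m => lam m * (∏ i, (k m i : ℝ)) / Real.sqrt (∏ i, (n m i : ℝ)))
      atTop (𝓝 0) := by
    refine tendsto_zero_of_tendsto_log_div hN (l := -β + d * α - d / 2) ?_ (by linarith)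
      (((hlam.add (hk.const_mul (d : ℝ))).sub_const ((d : ℝ) / 2)).congr' ?_)
    · filter_upwards [hkpos, hlampos, hN.eventually_gt_atTop 0] with m h1 h2 h3
      have h3' : (0 : ℝ) < maxSize n m := by exact_mod_cast h3
      simp_rw [hreg.cluster_eq m _ o, hnN, Finset.prod_const]
      positivity
    · filter_upwards [hkpos, hlampos, hN.eventually_gt_atTop 0, hlogN.eventually_gt_atTop 0]
        with m h1 h2 h3 h4
      have h3' : (0 : ℝ) < maxSize n m := by exact_mod_cast h3
      simp_rw [hreg.cluster_eq m _ o, hnN, Finset.prod_const, Finset.card_univ, Fintype.card_fin]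
      rw [Real.log_div (by positivity) (by positivity), Real.log_mul (by positivity)
        (by positivity), Real.log_sqrt (by positivity), Real.log_pow, Real.log_pow]
      field_simp
  have hsig : Tendsto (fun m => lam m ^ 2 * (k m o : ℝ) ^ (d - 1)) atTop (𝓝 0) := by
    have hd1 : ((d - 1 : ℕ) : ℝ) = d - 1 := by rw [Nat.cast_sub (by omega), Nat.cast_one]
    refine tendsto_zero_of_tendsto_log_div hN (l := 2 * -β + ((d : ℝ) - 1) * α) ?_ (by linarith)
      (((hlam.const_mul 2).add (hk.const_mul ((d : ℝ) - 1))).congr' ?_)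
    · filter_upwards [hkpos, hlampos] with m h1 h2
      positivity
    · filter_upwards [hkpos, hlampos] with m h1 h2
      rw [Real.log_mul (by positivity) (by positivity), Real.log_pow, Real.log_pow, hd1]
      push_cast
      ring
  filter_upwards [hlampos, eventually_mean_le hmean (Real.exp 2 ^ d) hη0,
    hsig.eventually_le_const hη0] with m h1 h2 h3
  rw [max_eq_left h1.le]
  refine le_chcMinimaxRisk_of_weak_signal (hkn m) h1.le hs ht hη0.le hη hηs h2 fun i => ?_
  simp_rw [hreg.cluster_eq m _ o]
  rwa [Finset.prod_const, Finset.card_erase_of_mem (Finset.mem_univ i), Finset.card_univ,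
    Fintype.card_fin]

end Asymptotics

end TensorClustering

theorem mainTheorem1 (d : ℕ) (hd : 2 ≤ d) (k n : ℕ → Fin d → ℕ) (lam : ℕ → ℝ)
    (hkn : ∀ m i, k m i ≤ n m i) :
    (TensorClustering.GrowingSparseRegime k n → TensorClustering.BalancedModes k n →
      Tendsto (fun m => lam m * (∏ i, (k m i : ℝ)) / Real.sqrt (∏ i, (n m i : ℝ))) atTop (𝓝 0) →
      limsup (fun m => ((lam m * Real.sqrt (∏ i, (k m i : ℝ)) /
        Real.sqrt (2 * ∑ i, (k m i : ℝ) * Real.log ((n m i : ℝ) / k m i)) : ℝ) : EReal)) atTop < 1 →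
      Tendsto (fun m => TensorClustering.chcMinimaxRisk (k m) (n m) (lam m)) atTop (𝓝 1)) ∧
    (∀ α β : ℝ, TensorClustering.PolynomialRegime k n lam α β →
      TensorClustering.chcDetectionThreshold d α < β →
      Tendsto (fun m => TensorClustering.chcMinimaxRisk (k m) (n m) (lam m)) atTop (𝓝 1)) :=
  ⟨TensorClustering.tendsto_chcMinimaxRisk_of_growingSparse hd hkn,
    fun _ _ => TensorClustering.tendsto_chcMinimaxRisk_of_polynomial hd hkn⟩
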